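/- Let $\Bbbk$ be a field, and let $A$ and $B$ be commutative Noetherian $\Bbbk$-algebras such that $A\otimes_\Bbbk B$ is Noetherian. Let $I\subseteq A$ and $J\subseteq B$ be ideals, and let $L$ and $N$ be nonzero finitely generated modules over $A$ and $B$, respectively; regard $L\otimes_\Bbbk N$ as an $A\otimes_\Bbbk B$-module via $(a\otimes b)(l\otimes n)=al\otimes bn$. Write $I\otimes_\Bbbk B$ and $A\otimes_\Bbbk J$ for the corresponding ideals of $A\otimes_\Bbbk B$. For an ideal $\mathfrak a$ of a Noetherian ring $R$ and a finitely generated $R$-module $M$, put $$\operatorname{grade}(\mathfrak a,M)=\inf\{i\ge 0: \mathrm H^i_{\mathfrak a}(M)\ne 0\},\qquad \operatorname{cd}(\mathfrak a,M)=\sup\{i\ge 0: \mathrm H^i_{\mathfrak a}(M)\neq 0\},$$ where $\mathrm H^i_{\mathfrak a}(M)=\varinjlim_n \operatorname{Ext}^i_R(R/\mathfrak a^n,M)$ is local cohomology, $\inf\emptyset=+\infty$ and $\sup\emptyset=-\infty$. Then (a) $\operatorname{grade}(I\otimes_\Bbbk B+A\otimes_\Bbbk J,\;L\otimes_\Bbbk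 N)=\operatorname{grade}(I,L)+\operatorname{grade}(J,N)$; (b) $\operatorname{cd}(I\otimes_\Bbbk B+A\otimes_\Bbbk J,\;L\otimes_\Bbbk N)=\operatorname{cd}(I,L)+\operatorname{cd}(J,N)$. Here $+\infty$ (in (a)) and $-\infty$ (in (b)) are absorbing for addition. -/

import Mathlib

open CategoryTheory CategoryTheory.Limits
open scoped TensorProduct

universe u w u₁ u₂

section LocalCohomologyInvariants

variable {R : Type u} [CommRing R]

/-- The grade of `M` with respect to `a`: the infimum of all `i` such that the `i`-th local
cohomology module of `M` with support in `a` is nonzero, where `inf ∅ = +∞`. -/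
noncomputable def lcGrade (a : Ideal R) (M : Type u) [AddCommGroup M] [Module R M] : ℕ∞ :=
  ⨅ (i : ℕ) (_ : ¬ IsZero ((localCohomology a i).obj (ModuleCat.of R M))), (i : ℕ∞)

/-- The cohomological dimension of `M` with respect to `a`: the supremum of all `i` such that the
`i`-th local cohomology module of `M` with support in `a` is nonzero, where `sup ∅ = -∞`. -/
noncomputable def lcCd (a : Ideal R) (M : Type u) [AddCommGroup M] [Module R M] : WithBot ℕ∞ :=
  ⨆ (i : ℕ) (_ : ¬ IsZero ((localCohomology a i).obj (ModuleCat.of R M))),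
    ((i : ℕ∞) : WithBot ℕ∞)

end LocalCohomologyInvariants

section ExternalTensorProduct

variable (k A B : Type*) [Field k] [CommRing A] [Algebra k A] [CommRing B] [Algebra k B]
variable (L N : Type*) [AddCommGroup L] [Module k L] [Module A L] [IsScalarTower k A L]
variable [AddCommGroup N] [Module k N] [Module B N] [IsScalarTower k B N]

/-- The action of `A ⊗[k] B` on `L ⊗[k] N` as an algebra homomorphism to `k`-linear
endomorphisms; `a ⊗ₜ b` acts as `(a • ·) ⊗ (b • ·)`. -/
noncomputable def externalTensorAction :
    A ⊗[k] B →ₐ[k] Module.End k (L ⊗[k] N) :=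
  (Module.endTensorEndAlgHom (R := k) (S := k) (A := k) (M := L) (N := N)).comp
    (Algebra.TensorProduct.map (Algebra.lsmul k k L) (Algebra.lsmul k k N))

/-- The `A ⊗[k] B`-module structure on `L ⊗[k] N`. It is not a global instance. -/
noncomputable abbrev externalTensorModule : Module (A ⊗[k] B) (L ⊗[k] N) :=
  Module.compHom (L ⊗[k] N) (externalTensorAction k A B L N).toRingHom

theorem externalTensorModule_tmul_smul_tmul (a : A) (b : B) (l : L) (n : N) :
    letI := externalTensorModule k A B L N
    (a ⊗ₜ[k] b) • (l ⊗ₜ[k] n) = (a • l) ⊗ₜ[k] (b • n) :=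
  rfl

end ExternalTensorProduct

/-- The ideal `I ⊗ B + A ⊗ J` of `A ⊗[k] B`; here `I ⊗ B` and `A ⊗ J` are the ideals of
`A ⊗[k] B` generated by the images of `I` and `J`, see `tensorSumIdeal_restrictScalars`. -/
noncomputable def tensorSumIdeal (k : Type*) {A B : Type*} [Field k] [CommRing A] [Algebra k A]
    [CommRing B] [Algebra k B] (I : Ideal A) (J : Ideal B) : Ideal (A ⊗[k] B) :=
  I.map (Algebra.TensorProduct.includeLeft : A →ₐ[k] A ⊗[k] B) +
    J.map (Algebra.TensorProduct.includeRight : B →ₐ[k] A ⊗[k] B)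

/-- As a `k`-subspace, `tensorSumIdeal k I J` is the sum of the images of `I ⊗[k] B` and
`A ⊗[k] J` in `A ⊗[k] B`. -/
theorem tensorSumIdeal_restrictScalars (k : Type*) {A B : Type*} [Field k] [CommRing A]
    [Algebra k A] [CommRing B] [Algebra k B] (I : Ideal A) (J : Ideal B) :
    (tensorSumIdeal k I J).restrictScalars k =
      LinearMap.range (LinearMap.rTensor B (Submodule.subtype (I.restrictScalars k))) ⊔
        LinearMap.range (LinearMap.lTensor A (Submodule.subtype (J.restrictScalars k))) := by
  rw [← Ideal.map_includeLeft_eq, ← Ideal.map_includeRight_eq]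
  ext x
  simp only [tensorSumIdeal, Submodule.restrictScalars_mem, Submodule.add_eq_sup, Submodule.mem_sup]

/-!
The theorem follows from a Künneth statement: `H^n` of `L ⊗ N` with support in `I ⊗ B + A ⊗ J` is
nonzero if and only if `H^i_I(L) ≠ 0` and `H^j_J(N) ≠ 0` for some `i + j = n`
(`not_isZero_localCohomology_tensorProduct_iff`). The set of degrees in which the left-hand side
lives is thus the sumset of the two sets of degrees on the right, and infima and suprema of sumsets
are sums of infima and suprema.

For the Künneth statement, choose resolutions of the modules `A ⧸ I ^ s` and `B ⧸ J ^ s` by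
finitely generated free modules, together with comparison maps for `s ≤ t`. The tensor product over
the field `k` of the resolutions of `A ⧸ I ^ s` and `B ⧸ J ^ s` is a projective resolution of
`(A ⧸ I ^ s) ⊗ (B ⧸ J ^ s)` (`IsProjectiveResolution.total`), which is the quotient of `A ⊗ B` by
`I ^ s ⊗ B + A ⊗ J ^ s` (`ExternalTensor.exists_quotientEquiv`); these ideals are cofinal among the
powers of `I ⊗ B + A ⊗ J`. Since the modules involved are finitely generated and projective, the
complex of homomorphisms from the tensor product of the resolutions to `L ⊗ N` is the tensor
product of the two `Hom` complexes (`ExternalTensor.totalHom_bijective`,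
`ExternalTensor.totalHom_raise`).

No cohomology modules are tensored. Local cohomology is a filtered colimit of `Ext` modules, so it
is nonzero if and only if some cocycle on some resolution never becomes a coboundary when it is
pulled back to the later ones (`HasStableClass`, `not_isZero_localCohomology_iff`). The product of
two stable cocycles is stable because a product of cocycles is a coboundary only if one of the
factors is (`ExternalTensor.not_isHomCoboundary_map`): linear functionals that vanish on
coboundaries separate the factors from `0`. Conversely, up to a coboundary every cocycle of the
tensor product of two complexes of vector spaces is a sum of products of cocycles
(`TotalTensor.exists_cocycle_projections`), and if no pair of degrees has stable classes on both
sides, each of these products eventually becomes a coboundary.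

Exactness of the tensor product of resolutions and the decomposition of cocycles both come from one
homotopy identity (`TotalTensor.proj_lower_raise_add_raise_lower`), applied to contracting
homotopies of complexes of vector spaces. Complexes are written as sequences of modules and maps;
the translation from Mathlib's `Ext` is confined to the first parts.
-/

/-! ### Classes in the homology of complexes in an opposite category -/

section OppositeHomology

variable {R : Type u} [CommRing R] {K K' : ChainComplex (ModuleCat.{u} R)ᵒᵖ ℕ} (n : ℕ)

/-- The element `φ` of `K.X n`, a cocycle once the arrows are turned around, represents the
homology class `x`. Mathlib computes `Ext` as a left derived functor with values in the opposite of
the category of modules, so `K` is a chain complex there; its homology embeds into `opcycles`, which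
after passing to the opposite is the module of cocycles, with homology as its quotient. -/
def RepresentsClass (K : ChainComplex (ModuleCat.{u} R)ᵒᵖ ℕ) (n : ℕ)
    (φ : (K.X n).unop) (x : (K.homology n).unop) : Prop :=
  ∃ z : (K.opcycles n).unop, (K.pOpcycles n).unop z = φ ∧ (K.homologyι n).unop z = x

theorem RepresentsClass.exists_rep (x : (K.homology n).unop) :
    ∃ φ, (K.d (n + 1) n).unop φ = 0 ∧ RepresentsClass K n φ x := by
  obtain ⟨z, hz⟩ := (ModuleCat.epi_iff_surjective _).1
    (inferInstance : Epi (K.homologyι n).unop) x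
  refine ⟨(K.pOpcycles n).unop z, ?_, z, rfl, hz⟩
  rw [← ModuleCat.comp_apply, ← unop_comp, K.d_pOpcycles]
  simp

theorem RepresentsClass.exists_class (φ : (K.X n).unop) (h : (K.d (n + 1) n).unop φ = 0) :
    ∃ x, RepresentsClass K n φ x := by
  have h1 := (ShortComplex.exact_of_g_is_cokernel
    (ShortComplex.mk _ _ (K.d_pOpcycles (n + 1) n)) (K.opcyclesIsCokernel (n + 1) n (by simp))).unop
  rw [ShortComplex.moduleCat_exact_iff] at h1
  obtain ⟨z, hz⟩ := h1 φ h
  exact ⟨_, z, hz, rfl⟩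

theorem RepresentsClass.eq_zero_iff {φ : (K.X n).unop} {x : (K.homology n).unop}
    (h : RepresentsClass K n φ x) :
    x = 0 ↔ ∃ j, ∃ ψ : (K.X j).unop, (K.d n j).unop ψ = φ := by
  obtain ⟨z, rfl, rfl⟩ := h
  constructor
  · intro hx
    have h1 := (ShortComplex.exact_of_f_is_kernel
      (ShortComplex.mk _ _ (K.homologyι_comp_fromOpcycles n _))
        (K.homologyIsKernel n _ rfl)).unop
    rw [ShortComplex.moduleCat_exact_iff] at h1
    obtain ⟨y, hy⟩ := h1 z hx
    refine ⟨_, y, ?_⟩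
    rw [← hy]
    exact congr(($(K.p_fromOpcycles n _)).unop y).symm
  · rintro ⟨j, ψ, h⟩
    have hz : z = (K.fromOpcycles n j).unop ψ := by
      apply (ModuleCat.mono_iff_injective _).1 (inferInstance : Mono (K.pOpcycles n).unop)
      rw [← h, ← ModuleCat.comp_apply, ← unop_comp, K.p_fromOpcycles]
    rw [hz, ← ModuleCat.comp_apply, ← unop_comp, K.homologyι_comp_fromOpcycles]
    simp

theorem RepresentsClass.map {φ : (K'.X n).unop} {x : (K'.homology n).unop}
    (h : RepresentsClass K' n φ x) (f : K ⟶ K') :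
    RepresentsClass K n ((f.f n).unop φ) ((HomologicalComplex.homologyMap f n).unop x) := by
  obtain ⟨z, rfl, rfl⟩ := h
  refine ⟨(HomologicalComplex.opcyclesMap f n).unop z, ?_, ?_⟩
  · rw [← ModuleCat.comp_apply, ← unop_comp, HomologicalComplex.p_opcyclesMap]
    simp
  · exact congr(($(HomologicalComplex.homologyι_naturality f n)).unop z).symm

end OppositeHomology

/-! ### Projective resolutions as sequences of linear maps -/

section LinearResolutions

variable {R : Type u} [CommRing R]

/-- The sequence `⋯ → X 1 → X 0 → Z → 0` with maps `d` and augmentation `ε` is a projective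
resolution of `Z`. Only modules and linear maps are involved, so that resolutions can be combined
by tensor products without going through categories. -/
structure IsProjectiveResolution {X : ℕ → Type u} [∀ n, AddCommGroup (X n)] [∀ n, Module R (X n)]
    {Z : Type u} [AddCommGroup Z] [Module R Z]
    (d : ∀ n, X (n + 1) →ₗ[R] X n) (ε : X 0 →ₗ[R] Z) : Prop where
  projective : ∀ n, Module.Projective R (X n)
  surjective : Function.Surjective ε
  exact_zero : Function.Exact (d 0) ε
  exact_succ : ∀ n, Function.Exact (d (n + 1)) (d n)

variable {X : ℕ → Type u} [∀ n, AddCommGroup (X n)] [∀ n, Module R (X n)]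
    {Z : Type u} [AddCommGroup Z] [Module R Z]
    {d : ∀ n, X (n + 1) →ₗ[R] X n} {ε : X 0 →ₗ[R] Z}
variable {X' : ℕ → Type u} [∀ n, AddCommGroup (X' n)] [∀ n, Module R (X' n)]
    {Z' : Type u} [AddCommGroup Z'] [Module R Z']
    {d' : ∀ n, X' (n + 1) →ₗ[R] X' n} {ε' : X' 0 →ₗ[R] Z'}

namespace IsProjectiveResolution

/-- The chain complex in `ModuleCat R` underlying a resolution. -/
noncomputable def complex (h : IsProjectiveResolution d ε) : ChainComplex (ModuleCat.{u} R) ℕ :=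
  ChainComplex.of (fun n => ModuleCat.of R (X n)) (fun n => ModuleCat.ofHom (d n)) (fun n => by
    ext x
    exact (h.exact_succ n).apply_apply_eq_zero x)

theorem complex_d (h : IsProjectiveResolution d ε) (n : ℕ) :
    h.complex.d (n + 1) n = ModuleCat.ofHom (d n) := by
  simp only [complex, ChainComplex.of_d]

/-- The resolution as a `ProjectiveResolution` in the category of modules. -/
noncomputable def resolution (h : IsProjectiveResolution d ε) :
    ProjectiveResolution (ModuleCat.of R Z) where
  complex := h.complex
  projective n := by
    have := h.projective n
    exact inferInstanceAs (Projective (ModuleCat.of R (X n)))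
  π := (ChainComplex.toSingle₀Equiv _ _).symm ⟨ModuleCat.ofHom ε, by
    rw [complex_d]
    ext x
    exact h.exact_zero.apply_apply_eq_zero x⟩
  quasiIso := ⟨fun n => by
    cases n
    · rw [ChainComplex.quasiIsoAt₀_iff, ShortComplex.quasiIso_iff_of_zeros']
      · refine (ShortComplex.exact_and_epi_g_iff_of_iso (S₂ := ShortComplex.mk
          (ModuleCat.ofHom (d 0)) (ModuleCat.ofHom ε) (by
            ext x
            exact h.exact_zero.apply_apply_eq_zero x)) ?_).2
          ⟨?_, ?_⟩
        · exact ShortComplex.isoMk (Iso.refl _) (Iso.refl _) (Iso.refl _)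
            (by simp [complex_d]; rfl) (by simp; rfl)
        · exact (ShortComplex.moduleCat_exact_iff _).2 fun x hx => (h.exact_zero x).1 hx
        · exact (ModuleCat.epi_iff_surjective _).2 h.surjective
      all_goals rfl
    · rename_i n
      rw [quasiIsoAt_iff_exactAt']
      · rw [HomologicalComplex.exactAt_iff' _ (n + 1 + 1) (n + 1) n (by simp) (by simp)]
        refine (ShortComplex.moduleCat_exact_iff _).2 fun x hx => ?_
        change (h.complex.d (n + 1) n) x = 0 at hx
        rw [complex_d] at hx
        obtain ⟨y, hy⟩ := (h.exact_succ n x).1 hx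
        refine ⟨y, ?_⟩
        change (h.complex.d (n + 1 + 1) (n + 1)) y = x
        rw [complex_d]
        exact hy
      · apply ChainComplex.exactAt_succ_single_obj⟩

theorem resolution_π (h : IsProjectiveResolution d ε) :
    h.resolution.π.f 0 = ModuleCat.ofHom ε := by
  simp [resolution]; rfl

/-- A linear map lifts to a map of resolutions. -/
theorem exists_lift (h : IsProjectiveResolution d ε) (h' : IsProjectiveResolution d' ε')
    (f : Z →ₗ[R] Z') : ∃ F : ∀ n, X n →ₗ[R] X' n,
      (∀ n, F n ∘ₗ d n = d' n ∘ₗ F (n + 1)) ∧ ε' ∘ₗ F 0 = f ∘ₗ ε := by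
  let g := ProjectiveResolution.lift (ModuleCat.ofHom f) h.resolution h'.resolution
  refine ⟨fun n => (g.f n).hom, fun n => ?_, ?_⟩
  · have := congr(ModuleCat.Hom.hom $(g.comm (n + 1) n))
    change _ = ModuleCat.Hom.hom (h.complex.d (n + 1) n ≫ _) at this
    change ModuleCat.Hom.hom (_ ≫ h'.complex.d (n + 1) n) = _ at this
    rw [complex_d, complex_d] at this
    exact this.symm
  · have := congr(ModuleCat.Hom.hom
      $(ProjectiveResolution.lift_commutes_zero (ModuleCat.ofHom f) h.resolution h'.resolution))
    rw [resolution_π, resolution_π] at this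
    exact this

end IsProjectiveResolution

end LinearResolutions

/-! ### Cocycles, `Ext` and stable classes -/

section Criterion

variable {R : Type u} [CommRing R]

/-- `φ : X n → M` is a coboundary in the complex `Hom(X, M)`. In degree `0` this means `φ = 0`. -/
def IsHomCoboundary {X : ℕ → Type*} [∀ n, AddCommGroup (X n)] [∀ n, Module R (X n)]
    (d : ∀ n, X (n + 1) →ₗ[R] X n) {M : Type*} [AddCommGroup M] [Module R M] :
    ∀ n, (X n →ₗ[R] M) → Prop
  | 0, φ => φ = 0
  | n + 1, φ => ∃ ψ : X n →ₗ[R] M, ψ ∘ₗ d n = φ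

/-- For a sequence of complexes `X s` with comparison maps `F s t : X t → X s`, some `n`-cocycle of
some `Hom(X s, M)` is not a coboundary in any later `Hom(X t, M)`; that is, the direct limit of the
cohomology modules is nonzero in degree `n`. -/
def HasStableClass {X : ℕ → ℕ → Type*} [∀ s n, AddCommGroup (X s n)] [∀ s n, Module R (X s n)]
    (d : ∀ s n, X s (n + 1) →ₗ[R] X s n) (F : ∀ s t, s ≤ t → ∀ n, X t n →ₗ[R] X s n)
    (M : Type*) [AddCommGroup M] [Module R M] (n : ℕ) : Prop :=
  ∃ s, ∃ φ : X s n →ₗ[R] M, φ ∘ₗ d s n = 0 ∧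
    ∀ t (hst : s ≤ t), ¬ IsHomCoboundary (d t) n (φ ∘ₗ F s t hst n)

variable {X : ℕ → Type u} [∀ n, AddCommGroup (X n)] [∀ n, Module R (X n)]
    {Z : Type u} [AddCommGroup Z] [Module R Z]
    {d : ∀ n, X (n + 1) →ₗ[R] X n} {ε : X 0 →ₗ[R] Z}
variable {X' : ℕ → Type u} [∀ n, AddCommGroup (X' n)] [∀ n, Module R (X' n)]
    {Z' : Type u} [AddCommGroup Z'] [Module R Z']
    {d' : ∀ n, X' (n + 1) →ₗ[R] X' n} {ε' : X' 0 →ₗ[R] Z'}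
variable {M : Type u} [AddCommGroup M] [Module R M]

namespace IsProjectiveResolution

variable (M) in
/-- The complex `Hom(X, M)`, seen as a chain complex in the opposite category. This is the complex
whose homology is `Ext` by Mathlib's definition. -/
noncomputable abbrev homComplex (h : IsProjectiveResolution d ε) :
    ChainComplex (ModuleCat.{u} R)ᵒᵖ ℕ :=
  ((((linearYoneda R (ModuleCat.{u} R)).obj (ModuleCat.of R M)).rightOp).mapHomologicalComplex
    _).obj h.complex

/-- The cocycle `φ` of `Hom(X, M)` represents the element `x` of `Ext^n(Z, M)`. -/
def RepresentsExt (h : IsProjectiveResolution d ε) (n : ℕ) (φ : X n →ₗ[R] M)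
    (x : ((Ext R (ModuleCat.{u} R) n).obj (Opposite.op (ModuleCat.of R Z))).obj
      (ModuleCat.of R M)) : Prop :=
  RepresentsClass (h.homComplex M) n (ModuleCat.ofHom φ)
    ((h.resolution.isoLeftDerivedObj
      ((linearYoneda R (ModuleCat.{u} R)).obj (ModuleCat.of R M)).rightOp n).inv.unop x)

theorem homComplex_d_unop (h : IsProjectiveResolution d ε) (n : ℕ) (φ : X n →ₗ[R] M) :
    ((h.homComplex M).d (n + 1) n).unop (ModuleCat.ofHom φ) = ModuleCat.ofHom (φ ∘ₗ d n) := by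
  change h.complex.d (n + 1) n ≫ ModuleCat.ofHom φ = _
  rw [complex_d]
  rfl

theorem exists_representsExt (h : IsProjectiveResolution d ε) (n : ℕ)
    (x : ((Ext R (ModuleCat.{u} R) n).obj (Opposite.op (ModuleCat.of R Z))).obj
      (ModuleCat.of R M)) : ∃ φ : X n →ₗ[R] M, φ ∘ₗ d n = 0 ∧ h.RepresentsExt n φ x := by
  obtain ⟨φ, hφ, hx⟩ := RepresentsClass.exists_rep (K := h.homComplex M) n
    ((h.resolution.isoLeftDerivedObj
      ((linearYoneda R (ModuleCat.{u} R)).obj (ModuleCat.of R M)).rightOp n).inv.unop x)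
  refine ⟨ModuleCat.Hom.hom φ, ?_, hx⟩
  exact congr(ModuleCat.Hom.hom $((h.homComplex_d_unop n (ModuleCat.Hom.hom φ)).symm.trans hφ))

theorem exists_ext_of_comp_eq_zero (h : IsProjectiveResolution d ε) (n : ℕ) (φ : X n →ₗ[R] M)
    (hφ : φ ∘ₗ d n = 0) : ∃ x, h.RepresentsExt n φ x := by
  obtain ⟨y, hy⟩ := RepresentsClass.exists_class (K := h.homComplex M) n (ModuleCat.ofHom φ) (by
    rw [homComplex_d_unop, hφ]; rfl)
  let e := (h.resolution.isoLeftDerivedObj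
      ((linearYoneda R (ModuleCat.{u} R)).obj (ModuleCat.of R M)).rightOp n)
  refine ⟨e.hom.unop y, ?_⟩
  have : e.inv.unop (e.hom.unop y) = y := congr(($(e.inv_hom_id)).unop y)
  unfold RepresentsExt
  erw [this]
  exact hy

theorem RepresentsExt.eq_zero_iff (h : IsProjectiveResolution d ε) {n : ℕ} {φ : X n →ₗ[R] M}
    {x} (hx : h.RepresentsExt n φ x) : x = 0 ↔ IsHomCoboundary d n φ := by
  let e := (h.resolution.isoLeftDerivedObj
      ((linearYoneda R (ModuleCat.{u} R)).obj (ModuleCat.of R M)).rightOp n)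
  have h1 : x = 0 ↔ e.inv.unop x = 0 := by
    constructor
    · rintro rfl; exact map_zero _
    · intro hx
      have : e.hom.unop (e.inv.unop x) = x := congr(($(e.hom_inv_id)).unop x)
      rw [← this, hx]; exact map_zero _
  refine (h1.trans (RepresentsClass.eq_zero_iff n hx)).trans ?_
  cases n with
  | zero =>
    constructor
    · rintro ⟨j, ψ₀, hψ⟩
      have : h.complex.d 0 j = 0 := h.complex.shape _ _ (by simp)
      obtain ⟨ψ, h2⟩ : ∃ ψ : h.complex.X j ⟶ ModuleCat.of R M,
        h.complex.d 0 j ≫ ψ = ModuleCat.ofHom φ := ⟨ψ₀, hψ⟩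
      rw [this, zero_comp] at h2
      exact congr(ModuleCat.Hom.hom $h2).symm
    · rintro (rfl : φ = 0)
      exact ⟨0, 0, map_zero _⟩
  | succ n =>
    constructor
    · rintro ⟨j, ψ₀, hψ⟩
      obtain ⟨ψ, h2⟩ : ∃ ψ : h.complex.X j ⟶ ModuleCat.of R M,
        h.complex.d (n + 1) j ≫ ψ = ModuleCat.ofHom φ := ⟨ψ₀, hψ⟩
      by_cases hj : j = n
      · subst hj
        exact ⟨ModuleCat.Hom.hom ψ, congr(ModuleCat.Hom.hom
          $((h.homComplex_d_unop j (ModuleCat.Hom.hom ψ)).symm.trans h2))⟩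
      · have : h.complex.d (n + 1) j = 0 := h.complex.shape _ _ (by simp; omega)
        rw [this, zero_comp] at h2
        refine ⟨0, ?_⟩
        rw [LinearMap.zero_comp]
        exact congr(ModuleCat.Hom.hom $h2)
    · rintro ⟨ψ, hψ⟩
      exact ⟨n, ModuleCat.ofHom ψ, (h.homComplex_d_unop n ψ).trans (congrArg ModuleCat.ofHom hψ)⟩

/-- Pulling a cocycle back along a lift of `f` computes the map induced by `f` on `Ext`. -/
theorem RepresentsExt.map (h : IsProjectiveResolution d ε) (h' : IsProjectiveResolution d' ε')
    (f : ModuleCat.of R Z ⟶ ModuleCat.of R Z')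
    (F : ∀ n, X n →ₗ[R] X' n) (hF : ∀ n, F n ∘ₗ d n = d' n ∘ₗ F (n + 1))
    (hf : ε' ∘ₗ F 0 = f.hom ∘ₗ ε) {n : ℕ} {φ : X' n →ₗ[R] M} {x}
    (hx : h'.RepresentsExt n φ x) :
    h.RepresentsExt n (φ ∘ₗ F n)
      ((((Ext R (ModuleCat.{u} R) n).map f.op).app (ModuleCat.of R M)) x) := by
  let G : h.complex ⟶ h'.complex := ChainComplex.ofHom
    (fun n => ModuleCat.ofHom (F n)) (fun n =>
      (congrArg (ModuleCat.ofHom (F (n + 1)) ≫ ·) (h'.complex_d n)).trans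
        ((congr(ModuleCat.ofHom $(hF n)).symm).trans
          (congrArg (· ≫ ModuleCat.ofHom (F n)) (h.complex_d n)).symm))
  let Y := ((linearYoneda R (ModuleCat.{u} R)).obj (ModuleCat.of R M)).rightOp
  have key := ProjectiveResolution.isoLeftDerivedObj_inv_naturality f h.resolution h'.resolution
    G (by rw [resolution_π, resolution_π]; exact congr(ModuleCat.ofHom $hf)) Y n
  have h1 := RepresentsClass.map n hx ((Y.mapHomologicalComplex _).map G)
  have h2 := congr(($key).unop x)
  unfold RepresentsExt
  exact (congrArg (RepresentsClass (h.homComplex M) n (ModuleCat.ofHom (φ ∘ₗ F n))) h2).mpr h1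

end IsProjectiveResolution

/-- A descending sequence of ideals as a diagram indexed by the opposite of `ℕ`. -/
def idealDiagram {b : ℕ → Ideal R} (hb : Antitone b) : ℕᵒᵖ ⥤ Ideal R where
  obj s := b s.unop
  map w := homOfLE (hb (leOfHom w.unop))

theorem not_isZero_ofDiagram_iff {b : ℕ → Ideal R} (hb : Antitone b)
    {X : ℕ → ℕ → Type u} [∀ s n, AddCommGroup (X s n)] [∀ s n, Module R (X s n)]
    {d : ∀ s n, X s (n + 1) →ₗ[R] X s n} {ε : ∀ s, X s 0 →ₗ[R] R ⧸ b s}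
    (h : ∀ s, IsProjectiveResolution (d s) (ε s))
    {F : ∀ s t, s ≤ t → ∀ n, X t n →ₗ[R] X s n}
    (hF : ∀ s t (hst : s ≤ t) n, F s t hst n ∘ₗ d t n = d s n ∘ₗ F s t hst (n + 1))
    (hε : ∀ s t (hst : s ≤ t), ε s ∘ₗ F s t hst 0 = Submodule.factor (hb hst) ∘ₗ ε t) (n : ℕ) :
    ¬ IsZero ((localCohomology.ofDiagram.{u, 0} (idealDiagram hb) n).obj (ModuleCat.of R M)) ↔
      HasStableClass d F M n := by
  let D := localCohomology.diagram (idealDiagram hb) n ⋙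
    (evaluation _ _).obj (ModuleCat.of R M)
  have e : (localCohomology.ofDiagram.{u, 0} (idealDiagram hb) n).obj (ModuleCat.of R M) ≅
      colimit D := colimitObjIsoColimitCompEvaluation _ _
  rw [e.isZero_iff, ModuleCat.isZero_iff_subsingleton, not_subsingleton_iff_nontrivial]
  have : PreservesFilteredColimitsOfSize.{0, 0} (forget (ModuleCat.{u} R)) :=
    preservesFilteredColimitsOfSize_shrink.{0, u, 0, u} (forget (ModuleCat.{u} R))
  have hD : ∀ s t (hst : s ≤ t) (φ : X s n →ₗ[R] M) (x : D.obj (Opposite.op (Opposite.op s))),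
      (h s).RepresentsExt n φ x →
      (h t).RepresentsExt n (φ ∘ₗ F s t hst n) (D.map (homOfLE hst).op.op x) := by
    intro s t hst φ x hx
    exact hx.map (h t) (h s) _ _ (hF s t hst) (hε s t hst)
  constructor
  · intro hnt
    obtain ⟨y, hy⟩ := exists_ne (0 : ToType (colimit D))
    obtain ⟨s, x, rfl⟩ := Concrete.colimit_exists_rep D y
    obtain ⟨s⟩ := s
    obtain ⟨s⟩ := s
    obtain ⟨φ, hφ, hx⟩ := (h s).exists_representsExt n x
    refine ⟨s, φ, hφ, fun t hst hc => hy ?_⟩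
    have h0 : D.map (homOfLE hst).op.op x = (0 : D.obj (Opposite.op (Opposite.op t))) :=
      ((hD s t hst φ x hx).eq_zero_iff).2 hc
    rw [← colimit.w D (homOfLE hst).op.op, ModuleCat.comp_apply, h0, map_zero]
  · rintro ⟨s, φ, hφ, hc⟩
    obtain ⟨x, hx⟩ : ∃ x : D.obj (Opposite.op (Opposite.op s)), (h s).RepresentsExt n φ x :=
      (h s).exists_ext_of_comp_eq_zero n φ hφ
    by_contra hsub
    rw [not_nontrivial_iff_subsingleton] at hsub
    have h0 : colimit.ι D (Opposite.op (Opposite.op s)) x = 0 := Subsingleton.elim _ _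
    obtain ⟨t, w, ht⟩ := Concrete.colimit_rep_eq_zero R D _ x h0
    obtain ⟨t⟩ := t
    obtain ⟨t⟩ := t
    have hst : s ≤ t := leOfHom w.unop.unop
    exact hc t hst (((hD s t hst φ x hx).eq_zero_iff).1 ht)

end Criterion

/-! ### Local cohomology along a cofinal sequence of ideals -/

section Cofinal

variable {R : Type u} [CommRing R]

/-- A descending sequence of ideals whose radicals contain `a`, as a diagram in the category that
Mathlib uses to show that local cohomology depends only on the radical. -/
def idealDiagramToSelfLERadical (a : Ideal R) {b : ℕ → Ideal R} (hb : Antitone b)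
    (hab : ∀ s, a ≤ (b s).radical) : ℕᵒᵖ ⥤ localCohomology.SelfLERadical a :=
  ObjectProperty.lift _ (idealDiagram hb) fun s => hab s.unop

theorem initial_idealDiagramToSelfLERadical [IsNoetherianRing R] (a : Ideal R) {b : ℕ → Ideal R}
    (hb : Antitone b) (hab : ∀ s, a ≤ (b s).radical) (hba : ∀ m, ∃ s, b s ≤ a ^ m) :
    (idealDiagramToSelfLERadical a hb hab).Initial where
  out J' := by
    apply +allowSynthFailures zigzag_isConnected
    · obtain ⟨m, hm⟩ := Ideal.exists_pow_le_of_le_radical_of_fg J'.2 (IsNoetherian.noetherian a)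
      obtain ⟨s, hs⟩ := hba m
      exact ⟨CostructuredArrow.mk (⟨⟨⟨hs.trans hm⟩⟩⟩ :
        (idealDiagramToSelfLERadical a hb hab).obj (Opposite.op s) ⟶ J')⟩
    · intro j1 j2
      apply Relation.ReflTransGen.single
      rcases le_total (Opposite.unop j1.left) (Opposite.unop j2.left) with h | h
      · right; exact ⟨CostructuredArrow.homMk (homOfLE h).op rfl⟩
      · left; exact ⟨CostructuredArrow.homMk (homOfLE h).op rfl⟩

theorem nonempty_localCohomology_iso_ofDiagram [IsNoetherianRing R] (a : Ideal R) {b : ℕ → Ideal R}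
    (hb : Antitone b) (hab : ∀ s, a ≤ (b s).radical) (hba : ∀ m, ∃ s, b s ≤ a ^ m) (n : ℕ) :
    Nonempty (localCohomology a n ≅ localCohomology.ofDiagram.{u, 0} (idealDiagram hb) n) := by
  have := initial_idealDiagramToSelfLERadical a hb hab hba
  exact ⟨(localCohomology.isoSelfLERadical a n).symm ≪≫
    (localCohomology.isoOfFinal.{u, u, 0} (idealDiagramToSelfLERadical a hb hab)
    (localCohomology.selfLERadicalDiagram.{u} a) n).symm⟩

/-- Local cohomology can be computed with resolutions of `R ⧸ b s` for any descending sequence of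
ideals `b` that is cofinal with the powers of `a`. -/
theorem not_isZero_localCohomology_iff [IsNoetherianRing R] {a : Ideal R} {b : ℕ → Ideal R}
    (hb : Antitone b) (hab : ∀ s, a ≤ (b s).radical) (hba : ∀ m, ∃ s, b s ≤ a ^ m)
    {X : ℕ → ℕ → Type u} [∀ s n, AddCommGroup (X s n)] [∀ s n, Module R (X s n)]
    {d : ∀ s n, X s (n + 1) →ₗ[R] X s n} {ε : ∀ s, X s 0 →ₗ[R] R ⧸ b s}
    (h : ∀ s, IsProjectiveResolution (d s) (ε s))
    {F : ∀ s t, s ≤ t → ∀ n, X t n →ₗ[R] X s n}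
    (hF : ∀ s t (hst : s ≤ t) n, F s t hst n ∘ₗ d t n = d s n ∘ₗ F s t hst (n + 1))
    (hε : ∀ s t (hst : s ≤ t), ε s ∘ₗ F s t hst 0 = Submodule.factor (hb hst) ∘ₗ ε t)
    (M : Type u) [AddCommGroup M] [Module R M] (n : ℕ) :
    ¬ IsZero ((localCohomology a n).obj (ModuleCat.of R M)) ↔
      HasStableClass d F M n := by
  obtain ⟨e⟩ := nonempty_localCohomology_iso_ofDiagram a hb hab hba n
  rw [(e.app (ModuleCat.of R M)).isZero_iff]
  exact not_isZero_ofDiagram_iff hb h hF hε n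

end Cofinal

/-! ### Resolutions by finitely generated free modules -/

section Free

variable {R : Type u} [CommRing R]

/-- From a submodule `S` of a finite free module, the kernel of a chosen surjection from a finite
free module onto `S`, as a submodule of the latter. -/
noncomputable def syzygyStep [IsNoetherianRing R] (S : Σ m : ℕ, Submodule R (Fin m → R)) :
    Σ m : ℕ, Submodule R (Fin m → R) :=
  ⟨(Module.Finite.exists_fin' R S.2).choose,
    LinearMap.ker (Module.Finite.exists_fin' R S.2).choose_spec.choose⟩

theorem exists_isProjectiveResolution [IsNoetherianRing R] (Z : Type u) [AddCommGroup Z]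
    [Module R Z] [Module.Finite R Z] :
    ∃ (m : ℕ → ℕ) (d : ∀ n, (Fin (m (n + 1)) → R) →ₗ[R] (Fin (m n) → R))
      (ε : (Fin (m 0) → R) →ₗ[R] Z), IsProjectiveResolution (X := fun n => Fin (m n) → R) d ε := by
  obtain ⟨m₀, ε, hε⟩ := Module.Finite.exists_fin' R Z
  let S : ℕ → Σ m : ℕ, Submodule R (Fin m → R) := fun n =>
    Nat.rec ⟨m₀, LinearMap.ker ε⟩ (fun _ => syzygyStep) n
  let f : ∀ n, (Fin (S (n + 1)).1 → R) →ₗ[R] (S n).2 := fun n =>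
    (Module.Finite.exists_fin' R (S n).2).choose_spec.choose
  have hf : ∀ n, Function.Surjective (f n) := fun n =>
    (Module.Finite.exists_fin' R (S n).2).choose_spec.choose_spec
  have hker : ∀ n, (S (n + 1)).2 = LinearMap.ker (f n) := fun n => rfl
  have hrange : ∀ n, LinearMap.range ((S n).2.subtype ∘ₗ f n) = (S n).2 := fun n => by
    rw [LinearMap.range_comp, LinearMap.range_eq_top.2 (hf n), Submodule.map_top,
      Submodule.range_subtype]
  refine ⟨fun n => (S n).1, fun n => (S n).2.subtype ∘ₗ f n, ε,
    ⟨fun n => inferInstance, hε, ?_, ?_⟩⟩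
  · exact LinearMap.exact_iff.2 (hrange 0).symm
  · intro n
    exact LinearMap.exact_iff.2
      ((LinearMap.ker_comp_of_ker_eq_bot _ (Submodule.ker_subtype _)).trans (hrange (n + 1)).symm)

end Free

/-! ### The total complex of a tensor product -/

section Total

variable (k : Type*) [CommRing k] (C D : ℕ → Type*)
  [∀ p, AddCommGroup (C p)] [∀ p, Module k (C p)] [∀ q, AddCommGroup (D q)] [∀ q, Module k (D q)]

/-- The degree `n` part of the tensor product of two graded modules: the (finite) product of all
`C p ⊗ D q` with `p + q = n`. -/
abbrev TotalTensor (n : ℕ) : Type _ :=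
  ∀ x : Finset.HasAntidiagonal.antidiagonal n, C x.1.1 ⊗[k] D x.1.2

variable {k C D}

namespace TotalTensor

variable (k C D) in
/-- The component in bidegree `(p, q)`. -/
def proj {n : ℕ} (p q : ℕ) (h : p + q = n) : TotalTensor k C D n →ₗ[k] C p ⊗[k] D q :=
  LinearMap.proj (φ := fun x : Finset.HasAntidiagonal.antidiagonal n => C x.1.1 ⊗[k] D x.1.2)
    ⟨(p, q), Finset.HasAntidiagonal.mem_antidiagonal.2 h⟩

@[ext]
theorem ext_proj {n : ℕ} {f g : TotalTensor k C D n}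
    (h : ∀ p q h, proj k C D p q h f = proj k C D p q h g) : f = g := by
  funext ⟨⟨p, q⟩, hx⟩
  exact h p q (Finset.HasAntidiagonal.mem_antidiagonal.1 hx)

/-- The map of degree `-1` with components `l ⊗ id` and, with the sign `(-1) ^ p`, `β ⊗ l'`. For
`β = id` it is the differential of the tensor product of the chain complexes `(C, l)` and `(D, l')`;
other choices of `β` serve as homotopies. -/
def lower (l : ∀ p, C (p + 1) →ₗ[k] C p) (β : ∀ p, C p →ₗ[k] C p)
    (l' : ∀ q, D (q + 1) →ₗ[k] D q) (n : ℕ) : TotalTensor k C D (n + 1) →ₗ[k] TotalTensor k C D n :=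
  LinearMap.pi fun x =>
    TensorProduct.map (l x.1.1) LinearMap.id ∘ₗ
      proj k C D (x.1.1 + 1) x.1.2
        (by have := Finset.HasAntidiagonal.mem_antidiagonal.1 x.2; omega) +
    (-1 : k) ^ x.1.1 • TensorProduct.map (β x.1.1) (l' x.1.2) ∘ₗ
      proj k C D x.1.1 (x.1.2 + 1) (by have := Finset.HasAntidiagonal.mem_antidiagonal.1 x.2; omega)

/-- The part of `raise` that raises the left index: `u ⊗ id`, and `0` in bidegrees `(0, q)`. -/
def raiseLeft (u : ∀ p, C p →ₗ[k] C (p + 1)) (n : ℕ) :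
    ∀ p q, p + q = n + 1 → (TotalTensor k C D n →ₗ[k] C p ⊗[k] D q)
  | 0, _, _ => 0
  | p + 1, q, h => TensorProduct.map (u p) LinearMap.id ∘ₗ proj k C D p q (by omega)

/-- The part of `raise` that raises the right index: `(-1) ^ p • (α ⊗ u')`, and `0` in bidegrees
`(p, 0)`. -/
def raiseRight (α : ∀ p, C p →ₗ[k] C p) (u' : ∀ q, D q →ₗ[k] D (q + 1)) (n : ℕ) :
    ∀ p q, p + q = n + 1 → (TotalTensor k C D n →ₗ[k] C p ⊗[k] D q)
  | _, 0, _ => 0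
  | p, q + 1, h => (-1 : k) ^ p • TensorProduct.map (α p) (u' q) ∘ₗ proj k C D p q (by omega)

/-- The map of degree `+1` with components `u ⊗ id` and, with the sign `(-1) ^ p`, `α ⊗ u'`. For
`α = id` it is the differential of the tensor product of the cochain complexes `(C, u)` and
`(D, u')`; other choices of `α` serve as homotopies. -/
def raise (u : ∀ p, C p →ₗ[k] C (p + 1)) (α : ∀ p, C p →ₗ[k] C p)
    (u' : ∀ q, D q →ₗ[k] D (q + 1)) (n : ℕ) : TotalTensor k C D n →ₗ[k] TotalTensor k C D (n + 1) :=
  LinearMap.pi fun x =>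
    raiseLeft u n x.1.1 x.1.2 (Finset.HasAntidiagonal.mem_antidiagonal.1 x.2) +
    raiseRight α u' n x.1.1 x.1.2 (Finset.HasAntidiagonal.mem_antidiagonal.1 x.2)

variable {l : ∀ p, C (p + 1) →ₗ[k] C p} {β : ∀ p, C p →ₗ[k] C p} {l' : ∀ q, D (q + 1) →ₗ[k] D q}
  {u : ∀ p, C p →ₗ[k] C (p + 1)} {α : ∀ p, C p →ₗ[k] C p} {u' : ∀ q, D q →ₗ[k] D (q + 1)}

theorem proj_lower {n : ℕ} (f : TotalTensor k C D (n + 1)) (p q : ℕ) (h : p + q = n) :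
    proj k C D p q h (lower l β l' n f) =
      TensorProduct.map (l p) LinearMap.id (proj k C D (p + 1) q (by omega) f) +
      (-1 : k) ^ p • TensorProduct.map (β p) (l' q) (proj k C D p (q + 1) (by omega) f) := rfl

theorem proj_raise {n : ℕ} (f : TotalTensor k C D n) (p q : ℕ) (h : p + q = n + 1) :
    proj k C D p q h (raise u α u' n f) = raiseLeft u n p q h f + raiseRight α u' n p q h f := rfl

theorem raiseLeft_zero {n : ℕ} (f : TotalTensor k C D n) (q : ℕ) (h : 0 + q = n + 1) :
    raiseLeft u n 0 q h f = 0 := rfl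

theorem raiseLeft_succ {n : ℕ} (f : TotalTensor k C D n) (p q : ℕ) (h : p + 1 + q = n + 1) :
    raiseLeft u n (p + 1) q h f =
      TensorProduct.map (u p) LinearMap.id (proj k C D p q (by omega) f) := rfl

theorem raiseRight_zero {n : ℕ} (f : TotalTensor k C D n) (p : ℕ) (h : p + 0 = n + 1) :
    raiseRight α u' n p 0 h f = 0 := by cases p <;> rfl

theorem raiseRight_succ {n : ℕ} (f : TotalTensor k C D n) (p q : ℕ) (h : p + (q + 1) = n + 1) :
    raiseRight α u' n p (q + 1) h f =
      (-1 : k) ^ p • TensorProduct.map (α p) (u' q) (proj k C D p q (by omega) f) := by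
  cases p <;> rfl

/-- The endomorphism `l ∘ u + u ∘ l` in each degree, where the second term is absent in
degree `0`. -/
def laplacian (l : ∀ p, C (p + 1) →ₗ[k] C p) (u : ∀ p, C p →ₗ[k] C (p + 1)) :
    ∀ p, C p →ₗ[k] C p
  | 0 => l 0 ∘ₗ u 0
  | p + 1 => l (p + 1) ∘ₗ u (p + 1) + u p ∘ₗ l p

section
variable (hα : ∀ p, α p ∘ₗ l p = l p ∘ₗ α (p + 1)) (hβ : ∀ p, β (p + 1) ∘ₗ u p = u p ∘ₗ β p)
  (hαβ : ∀ p, α p ∘ₗ β p = β p ∘ₗ α p)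

include hα hβ hαβ in
/-- The mixed terms of `lower ∘ raise + raise ∘ lower` cancel by the signs, and what is left acts on
each component by the two Laplacians. With `β = id` and `u`, `α`, `u'` a contraction of two exact
complexes this makes their tensor product exact; with `α = id` it splits off the cohomology of a
tensor product of cochain complexes. -/
theorem proj_lower_raise_add_raise_lower {n : ℕ} (f : TotalTensor k C D (n + 1)) (p q : ℕ)
    (h : p + q = n + 1) :
    proj k C D p q h (lower l β l' (n + 1) (raise u α u' (n + 1) f) +
        raise u α u' n (lower l β l' n f)) =
      TensorProduct.map (laplacian l u p) LinearMap.id (proj k C D p q h f) +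
        TensorProduct.map (β p ∘ₗ α p) (laplacian l' u' q) (proj k C D p q h f) := by
  rcases p with _ | p <;> rcases q with _ | q
  · omega
  all_goals
    simp only [map_add, add_zero, zero_add, proj_lower, proj_raise, raiseLeft_zero,
      raiseLeft_succ, raiseRight_zero, raiseRight_succ, map_smul, TensorProduct.map_map, smul_add,
      laplacian, TensorProduct.map_add_left, TensorProduct.map_add_right, LinearMap.add_apply,
      smul_smul, hα, hβ, hαβ, LinearMap.id_comp, LinearMap.comp_id, pow_succ, pow_zero]
  · module
  all_goals
    rcases neg_one_pow_eq_or k p with hp | hp <;> simp only [hp] <;> module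

theorem proj_lower_raise_zero (f : TotalTensor k C D 0) :
    proj k C D 0 0 rfl (lower l β l' 0 (raise u α u' 0 f)) =
      TensorProduct.map (laplacian l u 0) LinearMap.id (proj k C D 0 0 rfl f) +
        TensorProduct.map (β 0 ∘ₗ α 0) (laplacian l' u' 0) (proj k C D 0 0 rfl f) := by
  simp only [add_zero, zero_add, proj_lower, proj_raise, raiseLeft_zero, raiseLeft_succ,
    raiseRight_zero, raiseRight_succ, TensorProduct.map_map, laplacian, LinearMap.comp_id, pow_zero,
    one_smul]

end

end TotalTensor

end Total

/-! ### Splittings of complexes of vector spaces -/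

section Splitting

variable {k : Type*} [Field k] {C : ℕ → Type*} [∀ p, AddCommGroup (C p)] [∀ p, Module k (C p)]

/-- Every linear map of vector spaces has a generalized inverse. -/
theorem LinearMap.exists_generalizedInverse {V W : Type*} [AddCommGroup V] [Module k V]
    [AddCommGroup W] [Module k W] (f : V →ₗ[k] W) : ∃ g : W →ₗ[k] V, f ∘ₗ g ∘ₗ f = f := by
  obtain ⟨s, hs⟩ := f.rangeRestrict.exists_rightInverse_of_surjective f.range_rangeRestrict
  obtain ⟨r, hr⟩ := (LinearMap.range f).subtype.exists_leftInverse_of_injective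
    (Submodule.ker_subtype _)
  refine ⟨s ∘ₗ r, ?_⟩
  ext x
  have h1 : r (f x) = f.rangeRestrict x := LinearMap.congr_fun hr (f.rangeRestrict x)
  have h2 := LinearMap.congr_fun hs (f.rangeRestrict x)
  have h3 := congrArg Subtype.val h2
  simpa [h1] using h3

open TotalTensor in
/-- Every cochain complex of vector spaces is homotopy equivalent to its cohomology: there is a
homotopy `l` between the identity and a projection `π` that has values in the cocycles and kills the
coboundaries. -/
theorem exists_splitting_of_cochain (u : ∀ p, C p →ₗ[k] C (p + 1))
    (hu : ∀ p, u (p + 1) ∘ₗ u p = 0) :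
    ∃ (l : ∀ p, C (p + 1) →ₗ[k] C p) (π : ∀ p, C p →ₗ[k] C p),
      (∀ p, laplacian l u p + π p = LinearMap.id) ∧ (∀ p, u p ∘ₗ π p = 0) ∧
        ∀ p, π (p + 1) ∘ₗ u p = 0 := by
  choose l hl using fun p => (u p).exists_generalizedInverse
  have hul : ∀ p, u p ∘ₗ laplacian l u p = u p
    | 0 => hl 0
    | p + 1 => by
      rw [laplacian, LinearMap.comp_add, hl, ← LinearMap.comp_assoc, hu, LinearMap.zero_comp,
        add_zero]
  have hlu : ∀ p, laplacian l u (p + 1) ∘ₗ u p = u p := fun p => by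
    rw [laplacian, LinearMap.add_comp, LinearMap.comp_assoc, hu, LinearMap.comp_zero, zero_add,
      LinearMap.comp_assoc, hl]
  refine ⟨l, fun p => LinearMap.id - laplacian l u p, fun p => add_sub_cancel _ _,
    fun p => ?_, fun p => ?_⟩
  · rw [LinearMap.comp_sub, hul, LinearMap.comp_id, sub_self]
  · rw [LinearMap.sub_comp, hlu, LinearMap.id_comp, sub_self]

open TotalTensor in
/-- A chain complex of vector spaces that is exact in positive degrees has a homotopy `u` between
the identity and a projection `π` that is concentrated in degree `0` and kills the boundaries. -/
theorem exists_splitting_of_exact (l : ∀ p, C (p + 1) →ₗ[k] C p)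
    (hl : ∀ p, Function.Exact (l (p + 1)) (l p)) :
    ∃ (u : ∀ p, C p →ₗ[k] C (p + 1)) (π : ∀ p, C p →ₗ[k] C p),
      (∀ p, laplacian l u p + π p = LinearMap.id) ∧ π 0 ∘ₗ l 0 = 0 ∧ ∀ p, π (p + 1) = 0 := by
  choose g hg using fun p => (l p).exists_generalizedInverse
  have hll : ∀ p x, l p (l (p + 1) x) = 0 := fun p x => (hl p).apply_apply_eq_zero x
  have hg' : ∀ p x, l p (g p (l p x)) = l p x := fun p x => LinearMap.congr_fun (hg p) x
  -- On `C (p + 1)`, `g p ∘ l p` is a projection whose kernel is the space of cycles.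
  let u : ∀ p, C p →ₗ[k] C (p + 1)
    | 0 => g 0
    | p + 1 => g (p + 1) ∘ₗ (LinearMap.id - g p ∘ₗ l p)
  have hul : ∀ p x, u p (l p x) = g p (l p x)
    | 0, x => rfl
    | p + 1, x => by simp [u, hll]
  refine ⟨u, fun p => LinearMap.id - laplacian l u p, fun p => add_sub_cancel _ _, ?_, fun p => ?_⟩
  · ext x
    simp [laplacian, u, hg']
  · ext x
    obtain ⟨y, hy⟩ := (hl p (x - g p (l p x))).1 (by rw [map_sub, hg', sub_self])
    have : l (p + 1) (u (p + 1) x) = x - g p (l p x) := by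
      change l (p + 1) (g (p + 1) (x - g p (l p x))) = _
      rw [← hy, hg']
    simp [laplacian, this, hul]

end Splitting

/-! ### The Künneth theorem for complexes of vector spaces -/

section VectorSpaceKunneth

variable {k : Type*} [Field k] {C D : ℕ → Type*}
  [∀ p, AddCommGroup (C p)] [∀ p, Module k (C p)] [∀ q, AddCommGroup (D q)] [∀ q, Module k (D q)]

theorem LinearMap.exists_eq_comp_of_exact {V W Z Z' : Type*} [AddCommGroup V] [Module k V]
    [AddCommGroup W] [Module k W] [AddCommGroup Z] [Module k Z] [AddCommGroup Z'] [Module k Z']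
    {d : V →ₗ[k] W} {e : W →ₗ[k] Z} {ρ : W →ₗ[k] Z'} (he : Function.Surjective e)
    (hd : Function.Exact d e) (hρ : ρ ∘ₗ d = 0) : ∃ σ : Z →ₗ[k] Z', ρ = σ ∘ₗ e := by
  obtain ⟨s, hs⟩ := e.exists_rightInverse_of_surjective (LinearMap.range_eq_top.2 he)
  refine ⟨ρ ∘ₗ s, LinearMap.ext fun x => ?_⟩
  obtain ⟨y, hy⟩ := (hd (x - s (e x))).1 (by
    rw [map_sub, ← LinearMap.comp_apply e s, hs, LinearMap.id_apply, sub_self])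
  have h1 := LinearMap.congr_fun hρ y
  rw [LinearMap.comp_apply, hy, map_sub, LinearMap.zero_apply, sub_eq_zero] at h1
  exact h1

namespace TotalTensor

theorem lower_lower {l : ∀ p, C (p + 1) →ₗ[k] C p} {l' : ∀ q, D (q + 1) →ₗ[k] D q}
    (hl : ∀ p, l p ∘ₗ l (p + 1) = 0) (hl' : ∀ q, l' q ∘ₗ l' (q + 1) = 0) {n : ℕ}
    (f : TotalTensor k C D (n + 1 + 1)) :
    lower l (fun _ => LinearMap.id) l' n (lower l (fun _ => LinearMap.id) l' (n + 1) f) = 0 := by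
  ext p q h
  simp only [map_add, map_zero, proj_lower, map_smul, TensorProduct.map_map, hl, hl',
    LinearMap.comp_id, LinearMap.id_comp, TensorProduct.map_zero_left,
    TensorProduct.map_zero_right, LinearMap.zero_apply, smul_add, smul_zero, pow_succ]
  module

theorem map_laplacian_add {P : Type*} [AddCommGroup P] [Module k P] {Q : Type*} [AddCommGroup Q]
    [Module k Q] {f π : P →ₗ[k] P} {g ρ : Q →ₗ[k] Q} (hf : f + π = LinearMap.id)
    (hg : g + ρ = LinearMap.id)
    (x : P ⊗[k] Q) :
    TensorProduct.map f LinearMap.id x + TensorProduct.map π g x = x - TensorProduct.map π ρ x := by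
  have h₁ : TensorProduct.map f LinearMap.id x + TensorProduct.map π LinearMap.id x = x := by
    rw [← LinearMap.add_apply, ← TensorProduct.map_add_left, hf, TensorProduct.map_id,
      LinearMap.id_apply]
  have h₂ : TensorProduct.map π g x + TensorProduct.map π ρ x =
      TensorProduct.map π LinearMap.id x := by
    rw [← LinearMap.add_apply, ← TensorProduct.map_add_right, hg]
  rw [← h₂, ← add_assoc] at h₁
  exact eq_sub_of_add_eq h₁

theorem exact_lower {l : ∀ p, C (p + 1) →ₗ[k] C p} {l' : ∀ q, D (q + 1) →ₗ[k] D q}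
    (hl : ∀ p, Function.Exact (l (p + 1)) (l p)) (hl' : ∀ q, Function.Exact (l' (q + 1)) (l' q))
    (n : ℕ) :
    Function.Exact (lower l (fun _ => LinearMap.id) l' (n + 1))
      (lower l (fun _ => LinearMap.id) l' n) := by
  intro f
  constructor
  · intro hf
    obtain ⟨u, π, hu, hπ0, hπ⟩ := exists_splitting_of_exact l hl
    obtain ⟨u', π', hu', hπ0', hπ'⟩ := exists_splitting_of_exact l' hl'
    have hc : ∀ p, π p ∘ₗ l p = l p ∘ₗ π (p + 1)
      | 0 => by rw [hπ0, hπ, LinearMap.comp_zero]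
      | p + 1 => by rw [hπ, hπ, LinearMap.comp_zero, LinearMap.zero_comp]
    refine ⟨raise u π u' (n + 1) f, ?_⟩
    ext p q h
    have key := proj_lower_raise_add_raise_lower (l' := l') (u' := u') (u := u)
      (β := fun _ => LinearMap.id) hc (fun _ => rfl) (fun _ => rfl) f p q h
    rw [hf, map_zero, add_zero, LinearMap.id_comp, map_laplacian_add (hu p) (hu' q)] at key
    rw [key, sub_eq_self]
    rcases p with _ | p
    · obtain rfl : q = n + 1 := by omega
      simp [hπ']
    · simp [hπ]
  · rintro ⟨g, rfl⟩
    exact lower_lower (fun p => (hl p).linearMap_comp_eq_zero)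
      (fun q => (hl' q).linearMap_comp_eq_zero) g

theorem exact_lower_zero {l : ∀ p, C (p + 1) →ₗ[k] C p} {l' : ∀ q, D (q + 1) →ₗ[k] D q}
    (hl : ∀ p, Function.Exact (l (p + 1)) (l p)) (hl' : ∀ q, Function.Exact (l' (q + 1)) (l' q))
    {X Y : Type*} [AddCommGroup X] [Module k X] [AddCommGroup Y] [Module k Y]
    {ε : C 0 →ₗ[k] X} {ε' : D 0 →ₗ[k] Y} (hε : Function.Surjective ε)
    (hε' : Function.Surjective ε') (h₀ : Function.Exact (l 0) ε) (h₀' : Function.Exact (l' 0) ε') :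
    Function.Exact (lower l (fun _ => LinearMap.id) l' 0)
      (TensorProduct.map ε ε' ∘ₗ proj k C D 0 0 rfl) := by
  intro f
  constructor
  · intro hf
    obtain ⟨u, π, hu, hπ0, hπ⟩ := exists_splitting_of_exact l hl
    obtain ⟨u', π', hu', hπ0', hπ'⟩ := exists_splitting_of_exact l' hl'
    obtain ⟨σ, hσ⟩ := LinearMap.exists_eq_comp_of_exact hε h₀ hπ0
    obtain ⟨σ', hσ'⟩ := LinearMap.exists_eq_comp_of_exact hε' h₀' hπ0'
    refine ⟨raise u π u' 0 f, ?_⟩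
    ext p q h
    obtain rfl : p = 0 := by omega
    obtain rfl : q = 0 := by omega
    have key := proj_lower_raise_zero (l := l) (u := u) (α := π) (l' := l') (u' := u')
      (β := fun _ => LinearMap.id) f
    rw [LinearMap.id_comp, map_laplacian_add (hu 0) (hu' 0)] at key
    rw [key, sub_eq_self, hσ, hσ', TensorProduct.map_comp, LinearMap.comp_apply]
    rw [LinearMap.comp_apply] at hf
    rw [hf, map_zero]
  · rintro ⟨g, rfl⟩
    rw [LinearMap.comp_apply, proj_lower, map_add, map_smul, TensorProduct.map_map,
      TensorProduct.map_map, h₀.linearMap_comp_eq_zero, h₀'.linearMap_comp_eq_zero]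
    simp

/-- Up to a coboundary, a cocycle of a tensor product of cochain complexes of vector spaces lies in
the image of the tensor product of the spaces of cocycles. In degree `0` there are no
coboundaries. -/
theorem exists_cocycle_projections {u : ∀ p, C p →ₗ[k] C (p + 1)}
    {u' : ∀ q, D q →ₗ[k] D (q + 1)} (hu : ∀ p, u (p + 1) ∘ₗ u p = 0)
    (hu' : ∀ q, u' (q + 1) ∘ₗ u' q = 0) :
    ∃ (π : ∀ p, C p →ₗ[k] C p) (π' : ∀ q, D q →ₗ[k] D q),
      (∀ p, u p ∘ₗ π p = 0) ∧ (∀ q, u' q ∘ₗ π' q = 0) ∧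
      (∀ f : TotalTensor k C D 0, raise u (fun _ => LinearMap.id) u' 0 f = 0 →
        proj k C D 0 0 rfl f = TensorProduct.map (π 0) (π' 0) (proj k C D 0 0 rfl f)) ∧
      (∀ (n : ℕ) (f : TotalTensor k C D (n + 1)), raise u (fun _ => LinearMap.id) u' (n + 1) f = 0 →
        ∃ g, ∀ p q h, proj k C D p q h (f - raise u (fun _ => LinearMap.id) u' n g) =
          TensorProduct.map (π p) (π' q) (proj k C D p q h f)) := by
  obtain ⟨l, π, hl, hπ, hπ₂⟩ := exists_splitting_of_cochain u hu
  obtain ⟨l', π', hl', hπ', hπ₂'⟩ := exists_splitting_of_cochain u' hu'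
  refine ⟨π, π', hπ, hπ', fun f hf => ?_, fun n f hf => ⟨lower l π l' n f, fun p q h => ?_⟩⟩
  · have key := proj_lower_raise_zero (l := l) (u := u) (β := π) (l' := l') (u' := u')
      (α := fun _ => LinearMap.id) f
    rw [LinearMap.comp_id, map_laplacian_add (hl 0) (hl' 0), hf, map_zero, map_zero] at key
    exact sub_eq_zero.1 key.symm
  · have key := proj_lower_raise_add_raise_lower (l' := l') (u' := u') (l := l)
      (α := fun _ => LinearMap.id) (β := π) (fun _ => rfl) (fun p => (hπ₂ p).trans (hπ p).symm)
      (fun _ => rfl) f p q h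
    rw [LinearMap.comp_id, map_laplacian_add (hl p) (hl' q), hf, map_zero, zero_add] at key
    rw [map_sub, key, sub_sub_cancel]

end TotalTensor

end VectorSpaceKunneth

/-! ### External tensor products and their homomorphisms -/

section External

-- Low priority: on `A ⊗[k] B` itself the instance coming from the ring structure takes precedence.
attribute [local instance 50] externalTensorModule

variable {k A B : Type*} [Field k] [CommRing A] [Algebra k A] [CommRing B] [Algebra k B]
variable {L N : Type*} [AddCommGroup L] [Module k L] [Module A L] [IsScalarTower k A L]
variable [AddCommGroup N] [Module k N] [Module B N] [IsScalarTower k B N]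
variable {L' N' : Type*} [AddCommGroup L'] [Module k L'] [Module A L'] [IsScalarTower k A L']
variable [AddCommGroup N'] [Module k N'] [Module B N'] [IsScalarTower k B N']

namespace ExternalTensor

theorem tmul_smul_tmul (a : A) (b : B) (l : L) (n : N) :
    (a ⊗ₜ[k] b) • (l ⊗ₜ[k] n) = (a • l) ⊗ₜ[k] (b • n) := rfl

theorem smul_comm' (c : k) (r : A ⊗[k] B) (x : L ⊗[k] N) : r • c • x = c • r • x :=
  map_smul (externalTensorAction k A B L N r) c x

/-- An additive map that commutes with the pure tensors in `A ⊗ B` is `A ⊗ B`-linear. -/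
noncomputable def ofMapSMul {M M' : Type*} [AddCommGroup M] [AddCommGroup M'] [Module (A ⊗[k] B) M]
    [Module (A ⊗[k] B) M'] (f : M →+ M')
    (hf : ∀ (a : A) (b : B) x, f ((a ⊗ₜ[k] b) • x) = (a ⊗ₜ[k] b) • f x) :
    M →ₗ[A ⊗[k] B] M' where
  toFun := f
  map_add' := f.map_add
  map_smul' r x := by
    induction r with
    | zero => simp
    | tmul a b => exact hf a b x
    | add r s hr hs => simp_all [add_smul]

/-- The external tensor product of an `A`-linear and a `B`-linear map, as an `A ⊗ B`-linear map. -/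
noncomputable def map (f : L →ₗ[A] L') (g : N →ₗ[B] N') : L ⊗[k] N →ₗ[A ⊗[k] B] L' ⊗[k] N' :=
  ofMapSMul (TensorProduct.map (f.restrictScalars k) (g.restrictScalars k)).toAddMonoidHom
    fun a b x => by
      induction x with
      | zero => simp
      | tmul l n => simp [tmul_smul_tmul]
      | add x y hx hy => simp only [smul_add, map_add, hx, hy]

theorem map_apply (f : L →ₗ[A] L') (g : N →ₗ[B] N') (x : L ⊗[k] N) :
    map f g x = TensorProduct.map (f.restrictScalars k) (g.restrictScalars k) x := rfl

theorem map_tmul (f : L →ₗ[A] L') (g : N →ₗ[B] N') (l : L) (n : N) :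
    map f g (l ⊗ₜ[k] n) = f l ⊗ₜ[k] g n := rfl

theorem hom_ext {M : Type*} [AddCommGroup M] [Module (A ⊗[k] B) M]
    {f g : L ⊗[k] N →ₗ[A ⊗[k] B] M} (h : ∀ l n, f (l ⊗ₜ[k] n) = g (l ⊗ₜ[k] n)) : f = g := by
  ext x
  induction x with
  | zero => simp
  | tmul l n => exact h l n
  | add x y hx hy => simp only [map_add, hx, hy]

end ExternalTensor

/-- A finitely generated projective module has a finite dual basis. -/
theorem Module.Projective.exists_dualBasis (R P : Type*) [CommRing R] [AddCommGroup P] [Module R P]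
    [Module.Finite R P] [Module.Projective R P] :
    ∃ (m : ℕ) (e : Fin m → P) (c : Fin m → P →ₗ[R] R), ∀ x, ∑ i, c i x • e i = x := by
  obtain ⟨m, f, hf⟩ := Module.Finite.exists_fin' R P
  obtain ⟨g, hg⟩ := Module.projective_lifting_property f LinearMap.id hf
  refine ⟨m, fun i => f (Pi.single i 1), fun i => LinearMap.proj i ∘ₗ g, fun x => ?_⟩
  have h := LinearMap.congr_fun hg x
  conv_rhs => rw [← LinearMap.id_apply (R := R) x, ← h, LinearMap.comp_apply,
    ← Finset.univ_sum_single (g x), map_sum]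
  refine Finset.sum_congr rfl fun i _ => ?_
  rw [← map_smul]
  simp [← Pi.single_smul]

namespace ExternalTensor

variable {P Q : Type*} [AddCommGroup P] [Module k P] [Module A P] [IsScalarTower k A P]
  [AddCommGroup Q] [Module k Q] [Module B Q] [IsScalarTower k B Q]

theorem sum_smul_tmul {m m' : ℕ} {e : Fin m → P} {c : Fin m → P →ₗ[A] A}
    (hc : ∀ x, ∑ i, c i x • e i = x) {e' : Fin m' → Q} {c' : Fin m' → Q →ₗ[B] B}
    (hc' : ∀ y, ∑ j, c' j y • e' j = y) (x : P) (y : Q) :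
    ∑ i, ∑ j, (c i x ⊗ₜ[k] c' j y) • (e i ⊗ₜ[k] e' j) = x ⊗ₜ[k] y := by
  simp only [tmul_smul_tmul, ← TensorProduct.tmul_sum, ← TensorProduct.sum_tmul, hc, hc']

theorem projective [Module.Finite A P] [Module.Projective A P] [Module.Finite B Q]
    [Module.Projective B Q] : Module.Projective (A ⊗[k] B) (P ⊗[k] Q) := by
  obtain ⟨m, e, c, hc⟩ := Module.Projective.exists_dualBasis A P
  obtain ⟨m', e', c', hc'⟩ := Module.Projective.exists_dualBasis B Q
  -- The products of the members of the two dual bases form a dual basis of `P ⊗ Q`.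
  let f (i : Fin m) (j : Fin m') : P ⊗[k] Q →ₗ[A ⊗[k] B] A ⊗[k] B :=
    ofMapSMul
      (TensorProduct.map ((c i).restrictScalars k) ((c' j).restrictScalars k)).toAddMonoidHom
    fun a b x => by
      induction x with
      | zero => simp
      | tmul l n => simp [tmul_smul_tmul]
      | add x y hx hy => simp only [smul_add, map_add, hx, hy]
  refine Module.Projective.of_split
    (LinearMap.pi fun x : Fin m × Fin m' => f x.1 x.2)
    (∑ x : Fin m × Fin m', (LinearMap.proj x).smulRight (e x.1 ⊗ₜ[k] e' x.2))
    (hom_ext fun x y => ?_)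
  have := sum_smul_tmul (k := k) hc hc' x y
  rw [LinearMap.comp_apply, LinearMap.sum_apply, LinearMap.id_apply, Fintype.sum_prod_type]
  exact this

/-- The additive map `Hom_A(P, L) ⊗ Hom_B(Q, N) → Hom_{A ⊗ B}(P ⊗ Q, L ⊗ N)` that sends `f ⊗ g` to
the external tensor product of `f` and `g`. -/
noncomputable def homMap (k A B P Q L N : Type*) [Field k] [CommRing A] [Algebra k A] [CommRing B]
    [Algebra k B]
    [AddCommGroup P] [Module k P] [Module A P] [IsScalarTower k A P]
    [AddCommGroup Q] [Module k Q] [Module B Q] [IsScalarTower k B Q]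
    [AddCommGroup L] [Module k L] [Module A L] [IsScalarTower k A L]
    [AddCommGroup N] [Module k N] [Module B N] [IsScalarTower k B N] :
    (P →ₗ[A] L) ⊗[k] (Q →ₗ[B] N) →+ (P ⊗[k] Q →ₗ[A ⊗[k] B] L ⊗[k] N) :=
  TensorProduct.liftAddHom
    { toFun := fun f =>
      { toFun := fun g => map f g
        map_zero' := hom_ext fun x y => by simp [map_tmul]
        map_add' := fun g g' => hom_ext fun x y => by simp [map_tmul, TensorProduct.tmul_add] }
      map_zero' := by ext g : 1; exact hom_ext fun x y => by simp [map_tmul]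
      map_add' := fun f f' => by
        ext g : 1; exact hom_ext fun x y => by simp [map_tmul, TensorProduct.add_tmul] }
    (fun c f g => hom_ext fun x y => by simp [map_tmul, TensorProduct.smul_tmul])

theorem homMap_tmul (f : P →ₗ[A] L) (g : Q →ₗ[B] N) :
    homMap k A B P Q L N (f ⊗ₜ g) = map f g := rfl

theorem homMap_bijective [Module.Finite A P] [Module.Projective A P] [Module.Finite B Q]
    [Module.Projective B Q] : Function.Bijective (homMap k A B P Q L N) := by
  obtain ⟨m, e, c, hc⟩ := Module.Projective.exists_dualBasis A P
  obtain ⟨m', e', c', hc'⟩ := Module.Projective.exists_dualBasis B Q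
  -- The inverse sends `φ` to the sum over `i`, `j` of `κ i j (φ (e i ⊗ e' j))`, where `κ i j`
  -- sends `l ⊗ n` to the product of the maps `x ↦ c i x • l` and `y ↦ c' j y • n`.
  let κ (i : Fin m) (j : Fin m') : L ⊗[k] N →ₗ[k] (P →ₗ[A] L) ⊗[k] (Q →ₗ[B] N) :=
    TensorProduct.map
      { toFun := fun l => (c i).smulRight l
        map_add' := fun l l' => by ext; simp
        map_smul' := fun a l => LinearMap.ext fun x => smul_comm _ _ _ }
      { toFun := fun n => (c' j).smulRight n
        map_add' := fun l l' => by ext; simp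
        map_smul' := fun a l => LinearMap.ext fun x => smul_comm _ _ _ }
  have hκ : ∀ i j w x y, homMap k A B P Q L N (κ i j w) (x ⊗ₜ y) = (c i x ⊗ₜ[k] c' j y) • w := by
    intro i j w x y
    induction w with
    | zero => simp
    | tmul l n => rfl
    | add v w hv hw => simp only [map_add, LinearMap.add_apply, hv, hw, smul_add]
  have hκ' : ∀ (f : P →ₗ[A] L) (g : Q →ₗ[B] N),
      ∑ i, ∑ j, κ i j (f (e i) ⊗ₜ g (e' j)) = f ⊗ₜ[k] g := by
    intro f g
    simp only [κ, TensorProduct.map_tmul, LinearMap.coe_mk, AddHom.coe_mk,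
      ← TensorProduct.tmul_sum, ← TensorProduct.sum_tmul]
    congr 1
    · ext x
      simp only [LinearMap.sum_apply, LinearMap.smulRight_apply, ← map_smul, ← map_sum, hc]
    · ext x
      simp only [LinearMap.sum_apply, LinearMap.smulRight_apply, ← map_smul, ← map_sum, hc']
  have hleft : ∀ z, ∑ i, ∑ j, κ i j (homMap k A B P Q L N z (e i ⊗ₜ e' j)) = z := by
    intro z
    induction z with
    | zero => simp
    | tmul f g => exact hκ' f g
    | add v w hv hw => simp only [map_add, LinearMap.add_apply, Finset.sum_add_distrib, hv, hw]
  refine ⟨fun z z' h => by rw [← hleft z, h, hleft], fun φ =>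
    ⟨∑ i, ∑ j, κ i j (φ (e i ⊗ₜ e' j)), hom_ext fun x y => ?_⟩⟩
  simp only [map_sum, LinearMap.sum_apply, hκ]
  conv_rhs => rw [← sum_smul_tmul hc hc' x y]
  simp only [map_sum, map_smul]

end ExternalTensor

end External

/-! ### The tensor product of two resolutions -/

section TotalResolution

attribute [local instance 50] externalTensorModule

variable {k A B : Type*} [Field k] [CommRing A] [Algebra k A] [CommRing B] [Algebra k B]
variable {P : ℕ → Type*} [∀ p, AddCommGroup (P p)] [∀ p, Module k (P p)] [∀ p, Module A (P p)]
  [∀ p, IsScalarTower k A (P p)]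
variable {Q : ℕ → Type*} [∀ q, AddCommGroup (Q q)] [∀ q, Module k (Q q)] [∀ q, Module B (Q q)]
  [∀ q, IsScalarTower k B (Q q)]
variable {P' : ℕ → Type*} [∀ p, AddCommGroup (P' p)] [∀ p, Module k (P' p)] [∀ p, Module A (P' p)]
  [∀ p, IsScalarTower k A (P' p)]
variable {Q' : ℕ → Type*} [∀ q, AddCommGroup (Q' q)] [∀ q, Module k (Q' q)] [∀ q, Module B (Q' q)]
  [∀ q, IsScalarTower k B (Q' q)]

namespace ExternalTensor

open TotalTensor

theorem proj_smul {n : ℕ} (p q : ℕ) (h : p + q = n) (r : A ⊗[k] B) (f : TotalTensor k P Q n) :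
    proj k P Q p q h (r • f) = r • proj k P Q p q h f := rfl

variable (k) in
/-- The differential of the tensor product of two complexes of `A`- and `B`-modules. -/
noncomputable def totalD (d : ∀ p, P (p + 1) →ₗ[A] P p) (d' : ∀ q, Q (q + 1) →ₗ[B] Q q) (n : ℕ) :
    TotalTensor k P Q (n + 1) →ₗ[A ⊗[k] B] TotalTensor k P Q n where
  toFun := lower (fun p => (d p).restrictScalars k) (fun _ => LinearMap.id)
    (fun q => (d' q).restrictScalars k) n
  map_add' := map_add _
  map_smul' r f := by
    ext p q h
    have h₁ := (map (k := k) (d p) (LinearMap.id (R := B) (M := Q q))).map_smul r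
      (proj k P Q (p + 1) q (by omega) f)
    have h₂ := (map (k := k) (LinearMap.id (R := A) (M := P p)) (d' q)).map_smul r
      (proj k P Q p (q + 1) (by omega) f)
    rw [map_apply, map_apply] at h₁ h₂
    rw [RingHom.id_apply, proj_smul, proj_lower, proj_lower, smul_add, smul_comm']
    exact congrArg₂ (fun x y => x + (-1 : k) ^ p • y) h₁ h₂

variable (k A B P Q) in
/-- The component in bidegree `(p, q)`, as an `A ⊗ B`-linear map. -/
noncomputable def projHom {n : ℕ} (p q : ℕ) (h : p + q = n) :
    TotalTensor k P Q n →ₗ[A ⊗[k] B] P p ⊗[k] Q q :=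
  LinearMap.proj (φ := fun x : Finset.HasAntidiagonal.antidiagonal n => P x.1.1 ⊗[k] Q x.1.2)
    ⟨(p, q), Finset.HasAntidiagonal.mem_antidiagonal.2 h⟩

theorem projHom_apply {n : ℕ} (p q : ℕ) (h : p + q = n) (f : TotalTensor k P Q n) :
    projHom k A B P Q p q h f = proj k P Q p q h f := rfl

theorem projHom_surjective {n : ℕ} (p q : ℕ) (h : p + q = n) :
    Function.Surjective (projHom k A B P Q p q h) := fun x =>
  ⟨Pi.single (M := fun x : Finset.HasAntidiagonal.antidiagonal n => P x.1.1 ⊗[k] Q x.1.2)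
    ⟨(p, q), Finset.HasAntidiagonal.mem_antidiagonal.2 h⟩ x, Pi.single_eq_same _ _⟩

theorem projHom_totalD (d : ∀ p, P (p + 1) →ₗ[A] P p) (d' : ∀ q, Q (q + 1) →ₗ[B] Q q) {n : ℕ}
    (p q : ℕ) (h : p + q = n) (f : TotalTensor k P Q (n + 1)) :
    projHom k A B P Q p q h (totalD k d d' n f) =
      map (d p) (LinearMap.id : Q q →ₗ[B] Q q) (projHom k A B P Q (p + 1) q (by omega) f) +
        (-1 : k) ^ p • map (LinearMap.id : P p →ₗ[A] P p) (d' q)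
          (projHom k A B P Q p (q + 1) (by omega) f) := rfl

variable (k) in
/-- The map of tensor product complexes induced by maps of complexes. -/
noncomputable def totalMap (F : ∀ p, P p →ₗ[A] P' p) (G : ∀ q, Q q →ₗ[B] Q' q) (n : ℕ) :
    TotalTensor k P Q n →ₗ[A ⊗[k] B] TotalTensor k P' Q' n :=
  LinearMap.pi fun x => map (F x.1.1) (G x.1.2) ∘ₗ
    projHom k A B P Q x.1.1 x.1.2 (Finset.HasAntidiagonal.mem_antidiagonal.1 x.2)

theorem projHom_totalMap (F : ∀ p, P p →ₗ[A] P' p) (G : ∀ q, Q q →ₗ[B] Q' q) {n : ℕ}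
    (p q : ℕ) (h : p + q = n) (f : TotalTensor k P Q n) :
    projHom k A B P' Q' p q h (totalMap k F G n f) =
      map (F p) (G q) (projHom k A B P Q p q h f) := rfl

theorem map_map {X₁ X₂ X₃ Y₁ Y₂ Y₃ : Type*}
    [AddCommGroup X₁] [Module k X₁] [Module A X₁] [IsScalarTower k A X₁]
    [AddCommGroup X₂] [Module k X₂] [Module A X₂] [IsScalarTower k A X₂]
    [AddCommGroup X₃] [Module k X₃] [Module A X₃] [IsScalarTower k A X₃]
    [AddCommGroup Y₁] [Module k Y₁] [Module B Y₁] [IsScalarTower k B Y₁]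
    [AddCommGroup Y₂] [Module k Y₂] [Module B Y₂] [IsScalarTower k B Y₂]
    [AddCommGroup Y₃] [Module k Y₃] [Module B Y₃] [IsScalarTower k B Y₃]
    (f₂ : X₂ →ₗ[A] X₃) (g₂ : Y₂ →ₗ[B] Y₃) (f₁ : X₁ →ₗ[A] X₂) (g₁ : Y₁ →ₗ[B] Y₂) (z : X₁ ⊗[k] Y₁) :
    map f₂ g₂ (map f₁ g₁ z) = map (f₂ ∘ₗ f₁) (g₂ ∘ₗ g₁) z :=
  LinearMap.congr_fun (hom_ext (f := map f₂ g₂ ∘ₗ map f₁ g₁) (g := map (f₂ ∘ₗ f₁) (g₂ ∘ₗ g₁))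
    fun _ _ => rfl) z

theorem map_smul' {X₁ X₂ Y₁ Y₂ : Type*}
    [AddCommGroup X₁] [Module k X₁] [Module A X₁] [IsScalarTower k A X₁]
    [AddCommGroup X₂] [Module k X₂] [Module A X₂] [IsScalarTower k A X₂]
    [AddCommGroup Y₁] [Module k Y₁] [Module B Y₁] [IsScalarTower k B Y₁]
    [AddCommGroup Y₂] [Module k Y₂] [Module B Y₂] [IsScalarTower k B Y₂]
    (f : X₁ →ₗ[A] X₂) (g : Y₁ →ₗ[B] Y₂) (c : k) (z : X₁ ⊗[k] Y₁) :
    map f g (c • z) = c • map f g z := by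
  rw [map_apply, map_apply, map_smul]

theorem totalMap_comp_totalD {d : ∀ p, P (p + 1) →ₗ[A] P p} {d' : ∀ q, Q (q + 1) →ₗ[B] Q q}
    {d₂ : ∀ p, P' (p + 1) →ₗ[A] P' p} {d₂' : ∀ q, Q' (q + 1) →ₗ[B] Q' q}
    {F : ∀ p, P p →ₗ[A] P' p} {G : ∀ q, Q q →ₗ[B] Q' q}
    (hF : ∀ p, F p ∘ₗ d p = d₂ p ∘ₗ F (p + 1)) (hG : ∀ q, G q ∘ₗ d' q = d₂' q ∘ₗ G (q + 1))
    (n : ℕ) : totalMap k F G n ∘ₗ totalD k d d' n =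
      totalD k d₂ d₂' n ∘ₗ totalMap k F G (n + 1) := by
  refine LinearMap.ext fun f => ?_
  ext p q h
  simp only [← projHom_apply (A := A) (B := B), LinearMap.comp_apply, projHom_totalMap,
    projHom_totalD, map_add, map_smul', map_map, hF, hG, LinearMap.id_comp, LinearMap.comp_id]

theorem tensorQuotient_smul_one (I : Ideal A) (J : Ideal B) (r : A ⊗[k] B) :
    r • ((1 : A ⧸ I) ⊗ₜ[k] (1 : B ⧸ J)) =
      Algebra.TensorProduct.map (Ideal.Quotient.mkₐ k I) (Ideal.Quotient.mkₐ k J) r := by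
  induction r with
  | zero => simp
  | tmul a b =>
    rw [tmul_smul_tmul, Algebra.TensorProduct.map_tmul, Algebra.smul_def, Algebra.smul_def,
      mul_one, mul_one]
    rfl
  | add r s hr hs => rw [add_smul, hr, hs, map_add]

/-- The quotient of `A ⊗ B` by `I ⊗ B + A ⊗ J` is `(A ⧸ I) ⊗ (B ⧸ J)`, as an `A ⊗ B`-module. -/
theorem exists_quotientEquiv (I : Ideal A) (J : Ideal B) :
    ∃ e : (A ⧸ I) ⊗[k] (B ⧸ J) ≃ₗ[A ⊗[k] B] (A ⊗[k] B) ⧸ tensorSumIdeal k I J,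
      ∀ a b, e (Ideal.Quotient.mk I a ⊗ₜ Ideal.Quotient.mk J b) =
        Ideal.Quotient.mk (tensorSumIdeal k I J) (a ⊗ₜ b) := by
  let f : A ⊗[k] B →ₗ[A ⊗[k] B] (A ⧸ I) ⊗[k] (B ⧸ J) :=
    LinearMap.toSpanSingleton (A ⊗[k] B) _ ((1 : A ⧸ I) ⊗ₜ[k] (1 : B ⧸ J))
  have hf : ∀ r, f r =
      Algebra.TensorProduct.map (Ideal.Quotient.mkₐ k I) (Ideal.Quotient.mkₐ k J) r :=
    tensorQuotient_smul_one I J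
  have hI := Ideal.Quotient.mkₐ_surjective k I
  have hJ := Ideal.Quotient.mkₐ_surjective k J
  have hsurj : Function.Surjective f := fun z => by
    obtain ⟨r, hr⟩ := TensorProduct.map_surjective (g := (Ideal.Quotient.mkₐ k I).toLinearMap)
      (g' := (Ideal.Quotient.mkₐ k J).toLinearMap) hI hJ z
    exact ⟨r, (hf r).trans hr⟩
  have hker : tensorSumIdeal k I J = LinearMap.ker f := by
    have h := Algebra.TensorProduct.map_ker (Ideal.Quotient.mkₐ k I) (Ideal.Quotient.mkₐ k J) hI hJ
    have hI' : RingHom.ker (Ideal.Quotient.mkₐ k I) = I := by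
      ext; simp [RingHom.mem_ker, Ideal.Quotient.eq_zero_iff_mem]
    have hJ' : RingHom.ker (Ideal.Quotient.mkₐ k J) = J := by
      ext; simp [RingHom.mem_ker, Ideal.Quotient.eq_zero_iff_mem]
    rw [hI', hJ'] at h
    rw [tensorSumIdeal, Submodule.add_eq_sup, ← h]
    ext r
    rw [LinearMap.mem_ker, hf]
    rfl
  refine ⟨((Submodule.quotEquivOfEq _ _ hker).trans (f.quotKerEquivOfSurjective hsurj)).symm,
    fun a b => ?_⟩
  rw [LinearEquiv.symm_apply_eq]
  change _ = f (a ⊗ₜ b)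
  rw [hf]
  rfl

end ExternalTensor

end TotalResolution

section TotalResolution

attribute [local instance 50] externalTensorModule

variable {k : Type w} {A : Type u₁} {B : Type u₂} [Field k] [CommRing A] [Algebra k A]
  [CommRing B] [Algebra k B]
variable {P : ℕ → Type u₁} [∀ p, AddCommGroup (P p)] [∀ p, Module k (P p)] [∀ p, Module A (P p)]
  [∀ p, IsScalarTower k A (P p)] [∀ p, Module.Finite A (P p)]
variable {Q : ℕ → Type u₂} [∀ q, AddCommGroup (Q q)] [∀ q, Module k (Q q)] [∀ q, Module B (Q q)]
  [∀ q, IsScalarTower k B (Q q)] [∀ q, Module.Finite B (Q q)]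

open ExternalTensor TotalTensor in
/-- Over a field, the tensor product of projective resolutions by finitely generated modules is a
projective resolution. The isomorphism `e` allows for a target that is only isomorphic to `X ⊗ Y`,
such as a cyclic `A ⊗ B`-module. -/
theorem IsProjectiveResolution.total {X : Type u₁} [AddCommGroup X] [Module k X] [Module A X]
    [IsScalarTower k A X] {Y : Type u₂} [AddCommGroup Y] [Module k Y] [Module B Y]
    [IsScalarTower k B Y]
    {d : ∀ p, P (p + 1) →ₗ[A] P p} {ε : P 0 →ₗ[A] X} (h : IsProjectiveResolution d ε)
    {d' : ∀ q, Q (q + 1) →ₗ[B] Q q} {ε' : Q 0 →ₗ[B] Y} (h' : IsProjectiveResolution d' ε')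
    {Z : Type max u₁ u₂} [AddCommGroup Z] [Module (A ⊗[k] B) Z] (e : X ⊗[k] Y ≃ₗ[A ⊗[k] B] Z) :
    IsProjectiveResolution (totalD k d d')
      (e.toLinearMap ∘ₗ map ε ε' ∘ₗ projHom k A B P Q 0 0 rfl) where
  projective n := by
    have h₁ := h.projective
    have h₂ := h'.projective
    have : ∀ x : Finset.HasAntidiagonal.antidiagonal n,
      Module.Projective (A ⊗[k] B) (P x.1.1 ⊗[k] Q x.1.2) := fun x => ExternalTensor.projective
    exact Module.Projective.of_equiv' DFinsupp.linearEquivFunOnFintype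
  surjective := by
    intro z
    obtain ⟨y, rfl⟩ := e.surjective z
    obtain ⟨x, rfl⟩ := TensorProduct.map_surjective (R := k) (g := ε.restrictScalars k)
      (g' := ε'.restrictScalars k) h.surjective h'.surjective y
    obtain ⟨f, hf⟩ := projHom_surjective (k := k) (A := A) (B := B) (P := P) (Q := Q) 0 0 rfl x
    exact ⟨f, by rw [LinearMap.comp_apply, LinearMap.comp_apply, hf]; rfl⟩
  exact_zero f := by
    have := exact_lower_zero (l := fun p => (d p).restrictScalars k)
      (l' := fun p => (d' p).restrictScalars k) (ε := ε.restrictScalars k)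
      (ε' := ε'.restrictScalars k) h.exact_succ h'.exact_succ h.surjective h'.surjective
      h.exact_zero h'.exact_zero f
    rw [LinearMap.comp_apply, LinearEquiv.coe_coe, LinearEquiv.map_eq_zero_iff]
    exact this
  exact_succ n := exact_lower (l := fun p => (d p).restrictScalars k)
      (l' := fun p => (d' p).restrictScalars k) h.exact_succ h'.exact_succ n

end TotalResolution

/-! ### The `Hom` complex of a tensor product -/

section TotalHom

attribute [local instance 50] externalTensorModule

variable {k A B : Type*} [Field k] [CommRing A] [Algebra k A] [CommRing B] [Algebra k B]
variable {P : ℕ → Type*} [∀ p, AddCommGroup (P p)] [∀ p, Module k (P p)] [∀ p, Module A (P p)]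
  [∀ p, IsScalarTower k A (P p)]
variable {Q : ℕ → Type*} [∀ q, AddCommGroup (Q q)] [∀ q, Module k (Q q)] [∀ q, Module B (Q q)]
  [∀ q, IsScalarTower k B (Q q)]
variable {L N : Type*} [AddCommGroup L] [Module k L] [Module A L] [IsScalarTower k A L]
variable [AddCommGroup N] [Module k N] [Module B N] [IsScalarTower k B N]

theorem sum_antidiagonal_succ_left {M : Type*} [AddCommMonoid M] {n : ℕ}
    (a : ∀ p q, p + q = n + 1 → M) :
    ∑ x : Finset.HasAntidiagonal.antidiagonal (n + 1),
        a x.1.1 x.1.2 (Finset.HasAntidiagonal.mem_antidiagonal.1 x.2) =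
      a 0 (n + 1) (zero_add _) + ∑ x : Finset.HasAntidiagonal.antidiagonal n,
        a (x.1.1 + 1) x.1.2 (by have := Finset.HasAntidiagonal.mem_antidiagonal.1 x.2; omega) := by
  let b : ℕ × ℕ → M := fun x => if h : x.1 + x.2 = n + 1 then a x.1 x.2 h else 0
  have h := Finset.Nat.sum_antidiagonal_succ (n := n) (f := b)
  rw [← Finset.sum_coe_sort, ← Finset.sum_coe_sort (Finset.HasAntidiagonal.antidiagonal n)] at h
  convert h using 1
  · refine Finset.sum_congr rfl fun x _ => ?_
    simp only [b]
    rw [dif_pos (Finset.HasAntidiagonal.mem_antidiagonal.1 x.2)]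
  · congr 1
    · simp [b]
    · refine Finset.sum_congr rfl fun x _ => ?_
      have := Finset.HasAntidiagonal.mem_antidiagonal.1 x.2
      simp only [b]
      rw [dif_pos (by omega)]

theorem sum_antidiagonal_succ_right {M : Type*} [AddCommMonoid M] {n : ℕ}
    (a : ∀ p q, p + q = n + 1 → M) :
    ∑ x : Finset.HasAntidiagonal.antidiagonal (n + 1),
        a x.1.1 x.1.2 (Finset.HasAntidiagonal.mem_antidiagonal.1 x.2) =
      a (n + 1) 0 (add_zero _) + ∑ x : Finset.HasAntidiagonal.antidiagonal n,
        a x.1.1 (x.1.2 + 1) (by have := Finset.HasAntidiagonal.mem_antidiagonal.1 x.2; omega) := by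
  let b : ℕ × ℕ → M := fun x => if h : x.1 + x.2 = n + 1 then a x.1 x.2 h else 0
  have h := Finset.Nat.sum_antidiagonal_succ' (n := n) (f := b)
  rw [← Finset.sum_coe_sort, ← Finset.sum_coe_sort (Finset.HasAntidiagonal.antidiagonal n)] at h
  convert h using 1
  · refine Finset.sum_congr rfl fun x _ => ?_
    simp only [b]
    rw [dif_pos (Finset.HasAntidiagonal.mem_antidiagonal.1 x.2)]
  · congr 1
    · simp [b]
    · refine Finset.sum_congr rfl fun x _ => ?_
      have := Finset.HasAntidiagonal.mem_antidiagonal.1 x.2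
      simp only [b]
      rw [dif_pos (by omega)]

namespace ExternalTensor

open TotalTensor

variable (k L) in
/-- The differential `f ↦ f ∘ d` of the complex `Hom(P, L)`, as a `k`-linear map. There is no sign:
the signs are in `TotalTensor.raise`. -/
def homD (d : ∀ p, P (p + 1) →ₗ[A] P p) (p : ℕ) : (P p →ₗ[A] L) →ₗ[k] (P (p + 1) →ₗ[A] L) where
  toFun f := f ∘ₗ d p
  map_add' _ _ := rfl
  map_smul' _ _ := rfl

theorem homMap_map_left (d : ∀ p, P (p + 1) →ₗ[A] P p) (p q : ℕ)
    (y : (P p →ₗ[A] L) ⊗[k] (Q q →ₗ[B] N)) (z : P (p + 1) ⊗[k] Q q) :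
    homMap k A B (P (p + 1)) (Q q) L N (TensorProduct.map (homD k L d p) LinearMap.id y) z =
      homMap k A B (P p) (Q q) L N y (map (d p) (LinearMap.id : Q q →ₗ[B] Q q) z) := by
  induction y with
  | zero => simp
  | tmul f g =>
    rw [TensorProduct.map_tmul, homMap_tmul, homMap_tmul, map_map]
    rfl
  | add x y hx hy => simp only [map_add, LinearMap.add_apply, hx, hy]

theorem homMap_map_right (d' : ∀ q, Q (q + 1) →ₗ[B] Q q) (p q : ℕ)
    (y : (P p →ₗ[A] L) ⊗[k] (Q q →ₗ[B] N)) (z : P p ⊗[k] Q (q + 1)) :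
    homMap k A B (P p) (Q (q + 1)) L N (TensorProduct.map LinearMap.id (homD k N d' q) y) z =
      homMap k A B (P p) (Q q) L N y (map (LinearMap.id : P p →ₗ[A] P p) (d' q) z) := by
  induction y with
  | zero => simp
  | tmul f g =>
    rw [TensorProduct.map_tmul, homMap_tmul, homMap_tmul, map_map]
    rfl
  | add x y hx hy => simp only [map_add, LinearMap.add_apply, hx, hy]

theorem homMap_smul_apply {P Q : Type*} [AddCommGroup P] [Module k P] [Module A P]
    [IsScalarTower k A P] [AddCommGroup Q] [Module k Q] [Module B Q] [IsScalarTower k B Q]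
    (c : k) (y : (P →ₗ[A] L) ⊗[k] (Q →ₗ[B] N)) (z : P ⊗[k] Q) :
    homMap k A B P Q L N (c • y) z = homMap k A B P Q L N y (c • z) := by
  induction y with
  | zero => simp
  | tmul f g =>
    rw [TensorProduct.smul_tmul', homMap_tmul, homMap_tmul, map_smul', map_apply, map_apply]
    rw [← LinearMap.smul_apply, ← TensorProduct.map_smul_left]
    rfl
  | add x y hx hy => simp only [smul_add, map_add, LinearMap.add_apply, hx, hy]

/-- The additive map from the degree `n` part of `Hom(P, L) ⊗ Hom(Q, N)` to the homomorphisms from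
the degree `n` part of `P ⊗ Q` to `L ⊗ N`. -/
noncomputable def totalHom (k A B : Type*) [Field k] [CommRing A] [Algebra k A] [CommRing B]
    [Algebra k B] (P : ℕ → Type*) [∀ p, AddCommGroup (P p)] [∀ p, Module k (P p)]
    [∀ p, Module A (P p)] [∀ p, IsScalarTower k A (P p)]
    (Q : ℕ → Type*) [∀ q, AddCommGroup (Q q)] [∀ q, Module k (Q q)] [∀ q, Module B (Q q)]
    [∀ q, IsScalarTower k B (Q q)]
    (L N : Type*) [AddCommGroup L] [Module k L] [Module A L] [IsScalarTower k A L]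
    [AddCommGroup N] [Module k N] [Module B N] [IsScalarTower k B N] (n : ℕ) :
    TotalTensor k (fun p => P p →ₗ[A] L) (fun q => Q q →ₗ[B] N) n →+
      (TotalTensor k P Q n →ₗ[A ⊗[k] B] L ⊗[k] N) where
  toFun f := ∑ x : Finset.HasAntidiagonal.antidiagonal n,
    homMap k A B (P x.1.1) (Q x.1.2) L N (f x) ∘ₗ
      projHom k A B P Q x.1.1 x.1.2 (Finset.HasAntidiagonal.mem_antidiagonal.1 x.2)
  map_zero' := by simp
  map_add' f g := by simp [LinearMap.add_comp, Finset.sum_add_distrib]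

theorem totalHom_apply {n : ℕ} (f : TotalTensor k (fun p => P p →ₗ[A] L) (fun q => Q q →ₗ[B] N) n)
    (g : TotalTensor k P Q n) : totalHom k A B P Q L N n f g =
      ∑ x : Finset.HasAntidiagonal.antidiagonal n,
        homMap k A B (P x.1.1) (Q x.1.2) L N (f x) (g x) := by
  simp [totalHom, LinearMap.sum_apply]
  rfl

theorem totalHom_bijective [∀ p, Module.Finite A (P p)] [∀ p, Module.Projective A (P p)]
    [∀ q, Module.Finite B (Q q)] [∀ q, Module.Projective B (Q q)] (n : ℕ) :
    Function.Bijective (totalHom k A B P Q L N n) := by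
  have hs : ∀ (f : TotalTensor k (fun p => P p →ₗ[A] L) (fun q => Q q →ₗ[B] N) n) x z,
      totalHom k A B P Q L N n f (Pi.single x z) =
        homMap k A B (P x.1.1) (Q x.1.2) L N (f x) z := by
    intro f x z
    rw [totalHom_apply, Finset.sum_eq_single x, Pi.single_eq_same]
    · intro y _ hy
      rw [Pi.single_eq_of_ne hy, map_zero]
    · simp
  constructor
  · intro f g hfg
    funext x
    refine homMap_bijective.1 (LinearMap.ext fun z => ?_)
    rw [← hs, hfg, hs]
  · intro φ
    choose y hy using fun x : Finset.HasAntidiagonal.antidiagonal n =>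
      (homMap_bijective (k := k) (A := A) (B := B) (P := P x.1.1) (Q := Q x.1.2) (L := L)
        (N := N)).2 (φ ∘ₗ LinearMap.single (A ⊗[k] B)
          (fun x : Finset.HasAntidiagonal.antidiagonal n => P x.1.1 ⊗[k] Q x.1.2) x)
    refine ⟨y, LinearMap.pi_ext fun x z => ?_⟩
    rw [hs, hy]
    rfl

/-- `totalHom` is a map of complexes. -/
theorem totalHom_raise (d : ∀ p, P (p + 1) →ₗ[A] P p) (d' : ∀ q, Q (q + 1) →ₗ[B] Q q) (n : ℕ)
    (f : TotalTensor k (fun p => P p →ₗ[A] L) (fun q => Q q →ₗ[B] N) n) :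
    totalHom k A B P Q L N (n + 1)
        (raise (homD k L d) (fun _ => LinearMap.id) (homD k N d') n f) =
      totalHom k A B P Q L N n f ∘ₗ totalD k d d' n := by
  refine LinearMap.ext fun g => ?_
  rw [LinearMap.comp_apply, totalHom_apply, totalHom_apply]
  have h₁ := sum_antidiagonal_succ_left (n := n) fun p q h =>
    homMap k A B (P p) (Q q) L N (raiseLeft (homD k L d) n p q h f) (projHom k A B P Q p q h g)
  have h₂ := sum_antidiagonal_succ_right (n := n) fun p q h =>
    homMap k A B (P p) (Q q) L N (raiseRight (fun _ => LinearMap.id) (homD k N d') n p q h f)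
      (projHom k A B P Q p q h g)
  rw [raiseLeft_zero, map_zero, LinearMap.zero_apply, zero_add] at h₁
  rw [raiseRight_zero, map_zero, LinearMap.zero_apply, zero_add] at h₂
  calc _ = _ := ?_
    _ = _ := congrArg₂ (· + ·) h₁ h₂
    _ = _ := ?_
  · rw [← Finset.sum_add_distrib]
    refine Finset.sum_congr rfl fun x _ => ?_
    change homMap k A B (P x.1.1) (Q x.1.2) L N (_ + _) _ = _
    rw [map_add]
    rfl
  · rw [← Finset.sum_add_distrib]
    refine Finset.sum_congr rfl fun x _ => ?_
    have hx := Finset.HasAntidiagonal.mem_antidiagonal.1 x.2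
    change _ = homMap k A B (P x.1.1) (Q x.1.2) L N (f x)
      (projHom k A B P Q x.1.1 x.1.2 hx (totalD k d d' n g))
    rw [projHom_totalD, map_add, raiseLeft_succ, raiseRight_succ, homMap_map_left,
      homMap_smul_apply, homMap_map_right, map_smul']
    rfl

end ExternalTensor

end TotalHom

/-! ### Coboundaries and coherent comparison maps -/

section Coboundary

variable {R : Type*} [CommRing R] {X : ℕ → Type*} [∀ n, AddCommGroup (X n)] [∀ n, Module R (X n)]
  {d : ∀ n, X (n + 1) →ₗ[R] X n} {X' : ℕ → Type*} [∀ n, AddCommGroup (X' n)]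
  [∀ n, Module R (X' n)] {d' : ∀ n, X' (n + 1) →ₗ[R] X' n}
  {M : Type*} [AddCommGroup M] [Module R M]

namespace IsHomCoboundary

theorem zero : ∀ n, IsHomCoboundary d n (0 : X n →ₗ[R] M)
  | 0 => rfl
  | _ + 1 => ⟨0, rfl⟩

theorem add : ∀ {n} {φ ψ : X n →ₗ[R] M}, IsHomCoboundary d n φ → IsHomCoboundary d n ψ →
    IsHomCoboundary d n (φ + ψ)
  | 0, _, _, h, h' => by
    rw [show _ = _ from h, show _ = _ from h', add_zero]; rfl
  | _ + 1, _, _, ⟨α, h⟩, ⟨β, h'⟩ => ⟨α + β, by rw [LinearMap.add_comp, h, h']⟩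

theorem comp {F : ∀ n, X' n →ₗ[R] X n} (hF : ∀ n, F n ∘ₗ d' n = d n ∘ₗ F (n + 1)) :
    ∀ {n} {φ : X n →ₗ[R] M}, IsHomCoboundary d n φ → IsHomCoboundary d' n (φ ∘ₗ F n)
  | 0, _, h => by
    rw [show _ = _ from h, LinearMap.zero_comp]; rfl
  | n + 1, _, ⟨ψ, h⟩ => ⟨ψ ∘ₗ F n, by rw [← h, LinearMap.comp_assoc, hF, LinearMap.comp_assoc]⟩

end IsHomCoboundary

variable {X : ℕ → ℕ → Type*} [∀ s n, AddCommGroup (X s n)] [∀ s n, Module R (X s n)]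

/-- The comparison maps `F` compose correctly up to coboundaries on cocycles with values in `M`.
Lifts to resolutions are only unique up to homotopy, so `F s t ∘ F t t'` and `F s t'` differ in
general. -/
def IsCoherent (d : ∀ s n, X s (n + 1) →ₗ[R] X s n) (F : ∀ s t, s ≤ t → ∀ n, X t n →ₗ[R] X s n)
    (M : Type*) [AddCommGroup M] [Module R M] : Prop :=
  ∀ s t t' (hst : s ≤ t) (htt' : t ≤ t') n (φ : X s n →ₗ[R] M), φ ∘ₗ d s n = 0 →
    (IsHomCoboundary (d t') n ((φ ∘ₗ F s t hst n) ∘ₗ F t t' htt' n) ↔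
      IsHomCoboundary (d t') n (φ ∘ₗ F s t' (hst.trans htt') n))

end Coboundary

/-! ### Products of cocycles -/

theorem TotalTensor.proj_single {k : Type*} [CommRing k] {C D : ℕ → Type*}
    [∀ i, AddCommGroup (C i)] [∀ i, Module k (C i)] [∀ i, AddCommGroup (D i)]
    [∀ i, Module k (D i)] {i j n : ℕ} (h : i + j = n) (z : C i ⊗[k] D j) :
    TotalTensor.proj k C D i j h (Pi.single
      (M := fun x : Finset.HasAntidiagonal.antidiagonal n => C x.1.1 ⊗[k] D x.1.2)
      ⟨(i, j), Finset.HasAntidiagonal.mem_antidiagonal.2 h⟩ z) = z :=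
  Pi.single_eq_same (M := fun x : Finset.HasAntidiagonal.antidiagonal n => C x.1.1 ⊗[k] D x.1.2)
    ⟨(i, j), Finset.HasAntidiagonal.mem_antidiagonal.2 h⟩ z

section Functional

variable {k A : Type*} [Field k] [CommRing A] [Algebra k A]
variable {P : ℕ → Type*} [∀ p, AddCommGroup (P p)] [∀ p, Module A (P p)]
variable {L : Type*} [AddCommGroup L] [Module k L] [Module A L] [IsScalarTower k A L]

/-- A homomorphism that is not a coboundary is detected by a linear functional that vanishes on
coboundaries. -/
theorem exists_functional_of_not_isHomCoboundary {d : ∀ p, P (p + 1) →ₗ[A] P p} {i : ℕ}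
    {v : P i →ₗ[A] L} (hv : ¬ IsHomCoboundary d i v) :
    ∃ Φ : (P i →ₗ[A] L) →ₗ[k] k, Φ v ≠ 0 ∧ ∀ φ, IsHomCoboundary d i φ → Φ φ = 0 := by
  obtain ⟨S, hS⟩ : ∃ S : Submodule k (P i →ₗ[A] L), ∀ φ, φ ∈ S ↔ IsHomCoboundary d i φ := by
    cases i with
    | zero => exact ⟨⊥, fun φ => Submodule.mem_bot k⟩
    | succ i => exact ⟨LinearMap.range (ExternalTensor.homD k L d i), fun φ => Iff.rfl⟩
  obtain ⟨Φ, h₁, h₂⟩ := S.exists_le_ker_of_notMem (mt (hS v).1 hv)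
  exact ⟨Φ, h₁, fun φ hφ => h₂ ((hS φ).2 hφ)⟩

end Functional

section StableTotal

attribute [local instance 50] externalTensorModule

variable {k A B : Type*} [Field k] [CommRing A] [Algebra k A] [CommRing B] [Algebra k B]
variable {L N : Type*} [AddCommGroup L] [Module k L] [Module A L] [IsScalarTower k A L]
variable [AddCommGroup N] [Module k N] [Module B N] [IsScalarTower k B N]

namespace ExternalTensor
open TotalTensor

section
variable {P : ℕ → Type*} [∀ p, AddCommGroup (P p)] [∀ p, Module k (P p)] [∀ p, Module A (P p)]
  [∀ p, IsScalarTower k A (P p)]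
variable {Q : ℕ → Type*} [∀ q, AddCommGroup (Q q)] [∀ q, Module k (Q q)] [∀ q, Module B (Q q)]
  [∀ q, IsScalarTower k B (Q q)]
variable {d : ∀ p, P (p + 1) →ₗ[A] P p} {d' : ∀ q, Q (q + 1) →ₗ[B] Q q}

theorem map_smul_right {P Q : Type*} [AddCommGroup P] [Module k P] [Module A P]
    [IsScalarTower k A P] [AddCommGroup Q] [Module k Q] [Module B Q] [IsScalarTower k B Q]
    (v : P →ₗ[A] L) (w : Q →ₗ[B] N) (c : k) (z : P ⊗[k] Q) : map v (c • w) z = c • map v w z := by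
  rw [map_apply, map_apply, ← LinearMap.smul_apply, ← TensorProduct.map_smul_right]
  rfl

theorem map_comp_projHom_comp_totalD {i j n : ℕ} (h : i + j = n) {v : P i →ₗ[A] L} {w : Q j →ₗ[B] N}
    (hv : v ∘ₗ d i = 0) (hw : w ∘ₗ d' j = 0) :
    (map v w ∘ₗ projHom k A B P Q i j h) ∘ₗ totalD k d d' n = 0 := by
  refine LinearMap.ext fun f => ?_
  rw [LinearMap.comp_apply, LinearMap.comp_apply, projHom_totalD, map_add, map_smul', map_map,
    map_map, hv, hw]
  simp [map_apply]

theorem isHomCoboundary_left {i j n : ℕ} (h : i + j = n) {v : P i →ₗ[A] L} {w : Q j →ₗ[B] N}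
    (hv : IsHomCoboundary d i v) (hw : w ∘ₗ d' j = 0) :
    IsHomCoboundary (totalD k d d') n (map v w ∘ₗ projHom k A B P Q i j h) := by
  rcases i with _ | i
  · have : map (k := k) v w = 0 := by
      rw [show v = 0 from hv]
      exact hom_ext fun x y => by simp [map_tmul]
    rw [this, LinearMap.zero_comp]
    exact IsHomCoboundary.zero n
  · rcases n with _ | n
    · omega
    obtain ⟨ψ, rfl⟩ := hv
    refine ⟨map ψ w ∘ₗ projHom k A B P Q i j (by omega), LinearMap.ext fun f => ?_⟩
    rw [LinearMap.comp_apply, LinearMap.comp_apply, projHom_totalD, map_add, map_smul', map_map,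
      map_map, hw]
    simp [map_apply]

theorem isHomCoboundary_right {i j n : ℕ} (h : i + j = n) {v : P i →ₗ[A] L} {w : Q j →ₗ[B] N}
    (hv : v ∘ₗ d i = 0) (hw : IsHomCoboundary d' j w) :
    IsHomCoboundary (totalD k d d') n (map v w ∘ₗ projHom k A B P Q i j h) := by
  rcases j with _ | j
  · have : map (k := k) v w = 0 := by
      rw [show w = 0 from hw]
      exact hom_ext fun x y => by simp [map_tmul]
    rw [this, LinearMap.zero_comp]
    exact IsHomCoboundary.zero n
  · rcases n with _ | n
    · omega
    obtain ⟨ψ, rfl⟩ := hw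
    -- The sign `(-1) ^ i` of the differential is absorbed into `ψ`.
    refine ⟨map v ((-1 : k) ^ i • ψ) ∘ₗ projHom k A B P Q i j (by omega),
      LinearMap.ext fun f => ?_⟩
    rw [LinearMap.comp_apply, LinearMap.comp_apply, projHom_totalD, map_add, map_smul', map_map,
      map_map, hv, LinearMap.smul_comp, LinearMap.smul_comp, map_smul_right, map_smul_right,
      smul_smul, ← mul_pow]
    simp [map_apply]

theorem totalHom_single {i j n : ℕ} (h : i + j = n) (v : P i →ₗ[A] L) (w : Q j →ₗ[B] N) :
    totalHom k A B P Q L N n (Pi.single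
      (M := fun x : Finset.HasAntidiagonal.antidiagonal n =>
        (P x.1.1 →ₗ[A] L) ⊗[k] (Q x.1.2 →ₗ[B] N))
      ⟨(i, j), Finset.HasAntidiagonal.mem_antidiagonal.2 h⟩ (v ⊗ₜ w)) =
      map v w ∘ₗ projHom k A B P Q i j h := by
  refine LinearMap.ext fun g => ?_
  rw [totalHom_apply, Finset.sum_eq_single ⟨(i, j), Finset.HasAntidiagonal.mem_antidiagonal.2 h⟩,
    Pi.single_eq_same, homMap_tmul]
  · rfl
  · intro y _ hy
    rw [Pi.single_eq_of_ne hy, map_zero, LinearMap.zero_apply]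
  · simp

/-- A product of two homomorphisms that are not coboundaries is not a coboundary: with functionals
`Φ` and `Ψ` that vanish on coboundaries, `Φ ⊗ Ψ` kills the component of a coboundary in bidegree
`(i, j)`, but not `v ⊗ w`. -/
theorem not_isHomCoboundary_map [∀ p, Module.Finite A (P p)] [∀ p, Module.Projective A (P p)]
    [∀ q, Module.Finite B (Q q)] [∀ q, Module.Projective B (Q q)] {i j n : ℕ} (h : i + j = n)
    {v : P i →ₗ[A] L} {w : Q j →ₗ[B] N} (hv : ¬ IsHomCoboundary d i v)
    (hw : ¬ IsHomCoboundary d' j w) :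
    ¬ IsHomCoboundary (totalD k d d') n (map v w ∘ₗ projHom k A B P Q i j h) := by
  obtain ⟨Φ, hΦv, hΦ⟩ := exists_functional_of_not_isHomCoboundary (k := k) hv
  obtain ⟨Ψ, hΨw, hΨ⟩ := exists_functional_of_not_isHomCoboundary (k := k) hw
  have hne : TensorProduct.map Φ Ψ (v ⊗ₜ w) ≠ 0 := fun h0 => by
    have := congrArg (TensorProduct.lid k k) h0
    rw [TensorProduct.map_tmul, TensorProduct.lid_tmul, map_zero, smul_eq_mul] at this
    exact mul_ne_zero hΦv hΨw this
  rw [← totalHom_single]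
  intro hc
  apply hne
  rcases n with _ | n
  · have h0 := (totalHom_bijective _).1 ((show _ = _ from hc).trans (map_zero _).symm)
    have h2 : v ⊗ₜ[k] w = 0 := by
      rw [← proj_single (C := fun p => P p →ₗ[A] L) (D := fun q => Q q →ₗ[B] N) h (v ⊗ₜ[k] w), h0,
        map_zero]
    rw [h2, map_zero]
  · obtain ⟨ψ, hψ⟩ := hc
    obtain ⟨f, rfl⟩ := (totalHom_bijective (k := k) n).2 ψ
    rw [← totalHom_raise] at hψ
    rw [← proj_single (C := fun p => P p →ₗ[A] L) (D := fun q => Q q →ₗ[B] N) h (v ⊗ₜ[k] w),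
      ← (totalHom_bijective _).1 hψ, proj_raise, map_add]
    have e₁ : TensorProduct.map Φ Ψ (raiseLeft (homD k L d) n i j h f) = 0 := by
      rcases i with _ | i
      · rw [raiseLeft_zero, map_zero]
      · rw [raiseLeft_succ, TensorProduct.map_map,
          show Φ ∘ₗ homD k L d i = 0 from LinearMap.ext fun φ => hΦ _ ⟨φ, rfl⟩,
          TensorProduct.map_zero_left, LinearMap.zero_apply]
    have e₂ : TensorProduct.map Φ Ψ
        (raiseRight (fun _ => LinearMap.id) (homD k N d') n i j h f) = 0 := by
      rcases j with _ | j
      · rw [raiseRight_zero, map_zero]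
      · rw [raiseRight_succ, map_smul, TensorProduct.map_map,
          show Ψ ∘ₗ homD k N d' j = 0 from LinearMap.ext fun φ => hΨ _ ⟨φ, rfl⟩,
          TensorProduct.map_zero_right, LinearMap.zero_apply, smul_zero]
    rw [e₁, e₂, add_zero]

end

section
variable {P : ℕ → ℕ → Type*} [∀ s p, AddCommGroup (P s p)] [∀ s p, Module k (P s p)]
  [∀ s p, Module A (P s p)] [∀ s p, IsScalarTower k A (P s p)]
variable {Q : ℕ → ℕ → Type*} [∀ s q, AddCommGroup (Q s q)] [∀ s q, Module k (Q s q)]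
  [∀ s q, Module B (Q s q)] [∀ s q, IsScalarTower k B (Q s q)]
variable {d : ∀ s p, P s (p + 1) →ₗ[A] P s p} {d' : ∀ s q, Q s (q + 1) →ₗ[B] Q s q}
  {F : ∀ s t, s ≤ t → ∀ p, P t p →ₗ[A] P s p} {G : ∀ s t, s ≤ t → ∀ q, Q t q →ₗ[B] Q s q}

theorem map_comp_projHom_comp_totalMap {s t : ℕ} (hst : s ≤ t) {i j n : ℕ} (h : i + j = n)
    (v : P s i →ₗ[A] L) (w : Q s j →ₗ[B] N) :
    (map v w ∘ₗ projHom k A B (P s) (Q s) i j h) ∘ₗ totalMap k (F s t hst) (G s t hst) n =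
      map (v ∘ₗ F s t hst i) (w ∘ₗ G s t hst j) ∘ₗ projHom k A B (P t) (Q t) i j h := by
  refine LinearMap.ext fun f => ?_
  rw [LinearMap.comp_apply, LinearMap.comp_apply, projHom_totalMap, map_map]
  rfl

variable [∀ s p, Module.Finite A (P s p)] [∀ s p, Module.Projective A (P s p)]
  [∀ s q, Module.Finite B (Q s q)] [∀ s q, Module.Projective B (Q s q)]

/-- The product of two stable classes is stable. -/
theorem HasStableClass.total (hF : ∀ s t hst p, F s t hst p ∘ₗ d t p = d s p ∘ₗ F s t hst (p + 1))
    (hG : ∀ s t hst q, G s t hst q ∘ₗ d' t q = d' s q ∘ₗ G s t hst (q + 1))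
    (hFL : IsCoherent d F L) (hGN : IsCoherent d' G N) {i j n : ℕ} (h : i + j = n)
    (hL : HasStableClass d F L i) (hN : HasStableClass d' G N j) :
    HasStableClass (fun s => totalD k (d s) (d' s))
      (fun s t hst => totalMap k (F s t hst) (G s t hst)) (L ⊗[k] N) n := by
  obtain ⟨s₁, v, hv, hv'⟩ := hL
  obtain ⟨s₂, w, hw, hw'⟩ := hN
  have h₁ := le_max_left s₁ s₂
  have h₂ := le_max_right s₁ s₂
  refine ⟨max s₁ s₂, map (v ∘ₗ F _ _ h₁ i) (w ∘ₗ G _ _ h₂ j) ∘ₗ projHom k A B _ _ i j h,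
    map_comp_projHom_comp_totalD h ?_ ?_, fun t ht => ?_⟩
  · rw [LinearMap.comp_assoc, hF, ← LinearMap.comp_assoc, hv, LinearMap.zero_comp]
  · rw [LinearMap.comp_assoc, hG, ← LinearMap.comp_assoc, hw, LinearMap.zero_comp]
  · rw [map_comp_projHom_comp_totalMap ht]
    refine not_isHomCoboundary_map h ?_ ?_
    · rw [hFL _ _ _ h₁ ht i v hv]
      exact hv' _ _
    · rw [hGN _ _ _ h₂ ht j w hw]
      exact hw' _ _

/-- A stable class of a tensor product gives stable classes of the factors in complementary
degrees. -/
theorem exists_hasStableClass_of_total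
    (hF : ∀ s t hst p, F s t hst p ∘ₗ d t p = d s p ∘ₗ F s t hst (p + 1))
    (hG : ∀ s t hst q, G s t hst q ∘ₗ d' t q = d' s q ∘ₗ G s t hst (q + 1))
    (hd : ∀ s p, d s p ∘ₗ d s (p + 1) = 0) (hd' : ∀ s q, d' s q ∘ₗ d' s (q + 1) = 0)
    (hFL : IsCoherent d F L) (hGN : IsCoherent d' G N) {n : ℕ}
    (hT : HasStableClass (fun s => totalD k (d s) (d' s))
      (fun s t hst => totalMap k (F s t hst) (G s t hst)) (L ⊗[k] N) n) :
    ∃ i j, i + j = n ∧ HasStableClass d F L i ∧ HasStableClass d' G N j := by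
  by_contra! hcon
  obtain ⟨s, φ, hφ, hφ'⟩ := hT
  let T (t : ℕ) (hst : s ≤ t) := totalMap k (F s t hst) (G s t hst) n
  -- `Dies φ`: the pullbacks of `φ` are coboundaries from some point on.
  let Dies (φ : TotalTensor k (P s) (Q s) n →ₗ[A ⊗[k] B] L ⊗[k] N) : Prop :=
    ∃ t₀, ∀ t (hst : s ≤ t), t₀ ≤ t → IsHomCoboundary (totalD k (d t) (d' t)) n (φ ∘ₗ T t hst)
  have hTD : ∀ t hst m, totalMap k (F s t hst) (G s t hst) m ∘ₗ totalD k (d t) (d' t) m =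
      totalD k (d s) (d' s) m ∘ₗ totalMap k (F s t hst) (G s t hst) (m + 1) := fun t hst m =>
    totalMap_comp_totalD (hF s t hst) (hG s t hst) m
  have dies_add : ∀ φ ψ, Dies φ → Dies ψ → Dies (φ + ψ) := by
    rintro φ ψ ⟨t₁, h₁⟩ ⟨t₂, h₂⟩
    refine ⟨max t₁ t₂, fun t hst ht => ?_⟩
    rw [LinearMap.add_comp]
    exact (h₁ t hst ((le_max_left _ _).trans ht)).add (h₂ t hst ((le_max_right _ _).trans ht))
  have dies_zero : Dies 0 := ⟨0, fun t hst _ => by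
    rw [LinearMap.zero_comp]; exact IsHomCoboundary.zero n⟩
  have dies_cob : ∀ φ, IsHomCoboundary (totalD k (d s) (d' s)) n φ → Dies φ := fun φ h =>
    ⟨0, fun t hst _ => h.comp (hTD t hst)⟩
  have hvF : ∀ {i} {v : P s i →ₗ[A] L}, v ∘ₗ d s i = 0 → ∀ t hst,
      (v ∘ₗ F s t hst i) ∘ₗ d t i = 0 := fun hv t hst => by
    rw [LinearMap.comp_assoc, hF, ← LinearMap.comp_assoc, hv, LinearMap.zero_comp]
  have hwG : ∀ {j} {w : Q s j →ₗ[B] N}, w ∘ₗ d' s j = 0 → ∀ t hst,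
      (w ∘ₗ G s t hst j) ∘ₗ d' t j = 0 := fun hw t hst => by
    rw [LinearMap.comp_assoc, hG, ← LinearMap.comp_assoc, hw, LinearMap.zero_comp]
  have dies_map : ∀ i j (h : i + j = n) (v : P s i →ₗ[A] L) (w : Q s j →ₗ[B] N),
      v ∘ₗ d s i = 0 → w ∘ₗ d' s j = 0 → Dies (map v w ∘ₗ projHom k A B _ _ i j h) := by
    intro i j h v w hv hw
    by_cases hL : HasStableClass d F L i
    · have hN := hcon i j h hL
      simp only [HasStableClass, not_exists, not_and, not_forall, not_not] at hN
      obtain ⟨t₀, ht₀, hc⟩ := hN s w hw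
      refine ⟨t₀, fun t hst ht => ?_⟩
      rw [map_comp_projHom_comp_totalMap hst]
      exact isHomCoboundary_right h (hvF hv t hst)
        ((hGN _ _ _ ht₀ ht j w hw).1 (hc.comp (hG t₀ t ht)))
    · simp only [HasStableClass, not_exists, not_and, not_forall, not_not] at hL
      obtain ⟨t₀, ht₀, hc⟩ := hL s v hv
      refine ⟨t₀, fun t hst ht => ?_⟩
      rw [map_comp_projHom_comp_totalMap hst]
      exact isHomCoboundary_left h ((hFL _ _ _ ht₀ ht i v hv).1 (hc.comp (hF t₀ t ht)))
        (hwG hw t hst)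
  suffices Dies φ by
    obtain ⟨t₀, h⟩ := this
    exact hφ' _ (le_max_left s t₀) (h _ (le_max_left s t₀) (le_max_right s t₀))
  obtain ⟨f, rfl⟩ := (totalHom_bijective (k := k) n).2 φ
  obtain ⟨π, π', hπ, hπ', h0, hsucc⟩ := exists_cocycle_projections
    (u := homD k L (d s)) (u' := homD k N (d' s))
    (fun p => LinearMap.ext fun x => by
      change (x ∘ₗ d s p) ∘ₗ d s (p + 1) = 0
      rw [LinearMap.comp_assoc, hd, LinearMap.comp_zero])
    (fun p => LinearMap.ext fun x => by
      change (x ∘ₗ d' s p) ∘ₗ d' s (p + 1) = 0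
      rw [LinearMap.comp_assoc, hd', LinearMap.comp_zero])
  -- A family whose components are sums of products of cocycles dies.
  have dies_proj : ∀ f g : TotalTensor k (fun p => P s p →ₗ[A] L) (fun q => Q s q →ₗ[B] N) n,
      (∀ p q h, proj k _ _ p q h g = TensorProduct.map (π p) (π' q) (proj k _ _ p q h f)) →
      Dies (totalHom k A B (P s) (Q s) L N n g) := by
    intro f g hfg
    refine Finset.sum_induction _ Dies dies_add dies_zero fun x _ => ?_
    have hx := Finset.HasAntidiagonal.mem_antidiagonal.1 x.2
    have hgx : g x = TensorProduct.map (π x.1.1) (π' x.1.2) (f x) := hfg _ _ hx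
    rw [hgx]
    generalize f x = y
    induction y with
    | zero => rw [map_zero, map_zero, LinearMap.zero_comp]; exact dies_zero
    | tmul v w =>
      rw [TensorProduct.map_tmul, homMap_tmul]
      exact dies_map _ _ hx _ _ (LinearMap.congr_fun (hπ _) v) (LinearMap.congr_fun (hπ' _) w)
    | add y y' hy hy' => rw [map_add, map_add, LinearMap.add_comp]; exact dies_add _ _ hy hy'
  rw [← totalHom_raise] at hφ
  have hf := (totalHom_bijective _).1 (hφ.trans (map_zero _).symm)
  rcases n with _ | n
  · refine dies_proj f f fun p q h => ?_
    obtain rfl : p = 0 := by omega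
    obtain rfl : q = 0 := by omega
    exact h0 f hf
  · obtain ⟨g, hg⟩ := hsucc n f hf
    rw [← sub_add_cancel f (raise (homD k L (d s)) (fun _ => LinearMap.id) (homD k N (d' s)) n g),
      map_add]
    refine dies_add _ _ (dies_proj f _ hg) (dies_cob _ ?_)
    rw [totalHom_raise]
    exact ⟨_, rfl⟩

end

end ExternalTensor

end StableTotal

/-! ### Resolutions of a sequence of cyclic modules -/

section ResolutionSystem

variable {R : Type u} [CommRing R] {b : ℕ → Ideal R}

/-- Lifts of the canonical maps between the modules `R ⧸ b s` to resolutions are coherent, because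
both sides of the condition describe the same element of `Ext`. -/
theorem IsProjectiveResolution.isCoherent (hb : Antitone b)
    {X : ℕ → ℕ → Type u} [∀ s n, AddCommGroup (X s n)] [∀ s n, Module R (X s n)]
    {d : ∀ s n, X s (n + 1) →ₗ[R] X s n} {ε : ∀ s, X s 0 →ₗ[R] R ⧸ b s}
    (h : ∀ s, IsProjectiveResolution (d s) (ε s))
    {F : ∀ s t, s ≤ t → ∀ n, X t n →ₗ[R] X s n}
    (hF : ∀ s t (hst : s ≤ t) n, F s t hst n ∘ₗ d t n = d s n ∘ₗ F s t hst (n + 1))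
    (hε : ∀ s t (hst : s ≤ t), ε s ∘ₗ F s t hst 0 = Submodule.factor (hb hst) ∘ₗ ε t)
    (M : Type u) [AddCommGroup M] [Module R M] : IsCoherent d F M := by
  intro s t t' hst htt' n φ hφ
  obtain ⟨x, hx⟩ := (h s).exists_ext_of_comp_eq_zero n φ hφ
  let π (s t : ℕ) (hst : s ≤ t) : ModuleCat.of R (R ⧸ b t) ⟶ ModuleCat.of R (R ⧸ b s) :=
    ModuleCat.ofHom (Submodule.factor (hb hst))
  have h₁ := (hx.map (h t) (h s) (π s t hst) _ (hF s t hst) (hε s t hst)).map (h t') (h t)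
    (π t t' htt') _ (hF t t' htt') (hε t t' htt')
  have hst' := hst.trans htt'
  have h₂ := hx.map (h t') (h s) (π s t' hst') (F s t' hst') (hF s t' hst') (hε s t' hst')
  rw [← h₁.eq_zero_iff, ← h₂.eq_zero_iff]
  have hπ : π s t' (hst.trans htt') = π t t' htt' ≫ π s t hst := by
    refine ModuleCat.hom_ext (LinearMap.ext fun y => ?_)
    obtain ⟨y, rfl⟩ := Submodule.Quotient.mk_surjective _ y
    rfl
  rw [hπ, op_comp, Functor.map_comp]
  rfl

theorem exists_resolution_system [IsNoetherianRing R] (hb : Antitone b) :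
    ∃ (m : ℕ → ℕ → ℕ) (d : ∀ s n, (Fin (m s (n + 1)) → R) →ₗ[R] (Fin (m s n) → R))
      (ε : ∀ s, (Fin (m s 0) → R) →ₗ[R] R ⧸ b s)
      (F : ∀ s t, s ≤ t → ∀ n, (Fin (m t n) → R) →ₗ[R] (Fin (m s n) → R)),
      (∀ s, IsProjectiveResolution (X := fun n => Fin (m s n) → R) (d s) (ε s)) ∧
      (∀ s t hst n, F s t hst n ∘ₗ d t n = d s n ∘ₗ F s t hst (n + 1)) ∧
      ∀ s t (hst : s ≤ t), ε s ∘ₗ F s t hst 0 = Submodule.factor (hb hst) ∘ₗ ε t := by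
  choose m d ε h using fun s => exists_isProjectiveResolution (R := R) (R ⧸ b s)
  choose F hF hε using fun s t (hst : s ≤ t) =>
    (h t).exists_lift (h s) (Submodule.factor (hb hst))
  exact ⟨m, d, ε, F, h, hF, hε⟩

end ResolutionSystem

/-! ### The Künneth statement for local cohomology -/

section LocalCohomologyKunneth

theorem antitone_pow {R : Type*} [CommRing R] (a : Ideal R) : Antitone fun s : ℕ => a ^ s :=
  fun _ _ h => Ideal.pow_le_pow_right h

theorem le_radical_pow {R : Type*} [CommRing R] (a : Ideal R) (s : ℕ) : a ≤ (a ^ s).radical :=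
  fun _ hx => ⟨s, Ideal.pow_mem_pow hx s⟩

section
variable (k : Type*) {A B : Type*} [Field k] [CommRing A] [Algebra k A] [CommRing B] [Algebra k B]
  (I : Ideal A) (J : Ideal B)

theorem tensorSumIdeal_mono {I I' : Ideal A} {J J' : Ideal B} (hI : I ≤ I') (hJ : J ≤ J') :
    tensorSumIdeal k I J ≤ tensorSumIdeal k I' J' :=
  sup_le_sup (Ideal.map_mono hI) (Ideal.map_mono hJ)

theorem antitone_tensorSumIdeal_pow : Antitone fun s : ℕ => tensorSumIdeal k (I ^ s) (J ^ s) :=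
  fun _ _ h => tensorSumIdeal_mono k (antitone_pow I h) (antitone_pow J h)

theorem tensorSumIdeal_le_radical (s : ℕ) :
    tensorSumIdeal k I J ≤ (tensorSumIdeal k (I ^ s) (J ^ s)).radical := by
  refine sup_le ?_ ?_
  · refine (le_radical_pow _ s).trans (Ideal.radical_mono ?_)
    rw [← Ideal.map_pow]
    exact le_sup_left
  · refine (le_radical_pow _ s).trans (Ideal.radical_mono ?_)
    rw [← Ideal.map_pow]
    exact le_sup_right

theorem tensorSumIdeal_pow_le (m : ℕ) :
    tensorSumIdeal k (I ^ m) (J ^ m) ≤ tensorSumIdeal k I J ^ m := by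
  refine sup_le ?_ ?_
  · rw [Ideal.map_pow]
    exact Ideal.pow_right_mono le_sup_left m
  · rw [Ideal.map_pow]
    exact Ideal.pow_right_mono le_sup_right m

end

attribute [local instance 50] externalTensorModule

open ExternalTensor TotalTensor in
/-- A local cohomology module of an external tensor product is nonzero if and only if there are
nonzero local cohomology modules of the factors in complementary degrees. -/
theorem not_isZero_localCohomology_tensorProduct_iff (k : Type w) [Field k]
    (A : Type u₁) [CommRing A] [Algebra k A] [IsNoetherianRing A]
    (B : Type u₂) [CommRing B] [Algebra k B] [IsNoetherianRing B]
    [IsNoetherianRing (A ⊗[k] B)] (I : Ideal A) (J : Ideal B)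
    (L : Type u₁) [AddCommGroup L] [Module k L] [Module A L] [IsScalarTower k A L]
    (N : Type u₂) [AddCommGroup N] [Module k N] [Module B N] [IsScalarTower k B N] (n : ℕ) :
    ¬ IsZero ((localCohomology (tensorSumIdeal k I J) n).obj
        (ModuleCat.of (A ⊗[k] B) (L ⊗[k] N))) ↔
      ∃ i j, i + j = n ∧ ¬ IsZero ((localCohomology I i).obj (ModuleCat.of A L)) ∧
        ¬ IsZero ((localCohomology J j).obj (ModuleCat.of B N)) := by
  obtain ⟨m, d, ε, F, h, hF, hε⟩ := exists_resolution_system (antitone_pow I)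
  obtain ⟨m', d', ε', G, h', hG, hε'⟩ := exists_resolution_system (antitone_pow J)
  choose e he using fun s : ℕ => exists_quotientEquiv (k := k) (I ^ s) (J ^ s)
  have hFL := IsProjectiveResolution.isCoherent (X := fun s n => Fin (m s n) → A) (antitone_pow I)
    h hF hε L
  have hGN := IsProjectiveResolution.isCoherent (X := fun s n => Fin (m' s n) → B)
    (antitone_pow J) h' hG hε' N
  have hL : ∀ i, _ ↔ HasStableClass (X := fun s n => Fin (m s n) → A) d F L i := fun i =>
    not_isZero_localCohomology_iff (X := fun s n => Fin (m s n) → A) (antitone_pow I)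
      (le_radical_pow I) (fun s => ⟨s, le_rfl⟩) h hF hε L i
  have hN : ∀ j, _ ↔ HasStableClass (X := fun s n => Fin (m' s n) → B) d' G N j := fun j =>
    not_isZero_localCohomology_iff (X := fun s n => Fin (m' s n) → B) (antitone_pow J)
      (le_radical_pow J) (fun s => ⟨s, le_rfl⟩) h' hG hε' N j
  have hT : _ ↔ HasStableClass (fun s => totalD k (d s) (d' s))
      (fun s t hst => totalMap k (F s t hst) (G s t hst)) (L ⊗[k] N) n :=
    not_isZero_localCohomology_iff (X := fun s n =>
        TotalTensor k (fun p => Fin (m s p) → A) (fun q => Fin (m' s q) → B) n)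
      (antitone_tensorSumIdeal_pow k I J)
      (tensorSumIdeal_le_radical k I J) (fun s => ⟨s, tensorSumIdeal_pow_le k I J s⟩)
      (fun s => (h s).total (h' s) (e s))
      (fun s t hst => totalMap_comp_totalD (hF s t hst) (hG s t hst))
      (fun s t hst => LinearMap.ext fun f => by
        simp only [LinearMap.comp_apply, projHom_totalMap, map_map, hε, hε']
        generalize projHom k A B (fun p => Fin (m t p) → A) (fun q => Fin (m' t q) → B) 0 0 rfl f
          = z
        rw [← map_map]
        generalize map (ε t) (ε' t) z = y
        have := hom_ext (f := (e s).toLinearMap ∘ₗ map (Submodule.factor (antitone_pow I hst))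
            (Submodule.factor (antitone_pow J hst)))
          (g := Submodule.factor (antitone_tensorSumIdeal_pow k I J hst) ∘ₗ (e t).toLinearMap)
          fun a b => ?_
        · exact LinearMap.congr_fun this y
        obtain ⟨a, rfl⟩ := Ideal.Quotient.mk_surjective a
        obtain ⟨b, rfl⟩ := Ideal.Quotient.mk_surjective b
        exact (he s a b).trans (congrArg
            (Submodule.factor (antitone_tensorSumIdeal_pow k I J hst)) (he t a b)).symm)
      (L ⊗[k] N) n
  simp only [hL, hN]
  refine hT.trans ⟨fun H => ?_, ?_⟩
  · exact exists_hasStableClass_of_total hF hG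
      (fun s p => LinearMap.ext fun x => ((h s).exact_succ p).apply_apply_eq_zero x)
      (fun s p => LinearMap.ext fun x => ((h' s).exact_succ p).apply_apply_eq_zero x) hFL hGN H
  · rintro ⟨i, j, hij, hi, hj⟩
    exact HasStableClass.total hF hG hFL hGN hij hi hj

end LocalCohomologyKunneth

/-! ### Extrema of sets of degrees -/

section Extrema

theorem iInf_coe_add_of_forall_iff (P Q R : ℕ → Prop)
    (h : ∀ n, R n ↔ ∃ i j, i + j = n ∧ P i ∧ Q j) :
    ⨅ (n : ℕ) (_ : R n), (n : ℕ∞) =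
      (⨅ (n : ℕ) (_ : P n), (n : ℕ∞)) + ⨅ (n : ℕ) (_ : Q n), (n : ℕ∞) := by
  refine le_antisymm ?_ ?_
  · by_cases hP : ∃ i, P i
    · by_cases hQ : ∃ j, Q j
      · obtain ⟨i, hi, hi'⟩ : ∃ i, P i ∧ (⨅ (n : ℕ) (_ : P n), (n : ℕ∞)) = i := by
          classical
          exact ⟨Nat.find hP, Nat.find_spec hP, le_antisymm (iInf₂_le _ (Nat.find_spec hP))
            (le_iInf₂ fun n hn => by exact_mod_cast Nat.find_min' hP hn)⟩
        obtain ⟨j, hj, hj'⟩ : ∃ i, Q i ∧ (⨅ (n : ℕ) (_ : Q n), (n : ℕ∞)) = i := by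
          classical
          exact ⟨Nat.find hQ, Nat.find_spec hQ, le_antisymm (iInf₂_le _ (Nat.find_spec hQ))
            (le_iInf₂ fun n hn => by exact_mod_cast Nat.find_min' hQ hn)⟩
        rw [hi', hj', ← Nat.cast_add]
        exact iInf₂_le _ ((h _).2 ⟨i, j, rfl, hi, hj⟩)
      · push Not at hQ
        simp [hQ]
    · push Not at hP
      simp [hP]
  · refine le_iInf₂ fun n hn => ?_
    obtain ⟨i, j, rfl, hi, hj⟩ := (h n).1 hn
    rw [Nat.cast_add]
    exact add_le_add (iInf₂_le i hi) (iInf₂_le j hj)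

theorem iSup_coe_add_of_forall_iff (P Q R : ℕ → Prop)
    (h : ∀ n, R n ↔ ∃ i j, i + j = n ∧ P i ∧ Q j) :
    ⨆ (n : ℕ) (_ : R n), ((n : ℕ∞) : WithBot ℕ∞) =
      (⨆ (n : ℕ) (_ : P n), ((n : ℕ∞) : WithBot ℕ∞)) +
        ⨆ (n : ℕ) (_ : Q n), ((n : ℕ∞) : WithBot ℕ∞) := by
  -- On a nonempty set the supremum can be computed in `ℕ∞`, where addition preserves suprema.
  have hcoe : ∀ S : ℕ → Prop, (∃ i, S i) → (⨆ (n : ℕ) (_ : S n), ((n : ℕ∞) : WithBot ℕ∞)) =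
      ((⨆ n : {n // S n}, ((n : ℕ) : ℕ∞) : ℕ∞) : WithBot ℕ∞) := by
    rintro S ⟨i, hi⟩
    have : Nonempty {n // S n} := ⟨i, hi⟩
    rw [WithBot.coe_iSup (OrderTop.bddAbove _), iSup_subtype]
  refine le_antisymm (iSup₂_le fun n hn => ?_) ?_
  · obtain ⟨i, j, rfl, hi, hj⟩ := (h n).1 hn
    push_cast
    exact add_le_add (le_iSup₂_of_le i hi le_rfl) (le_iSup₂_of_le j hj le_rfl)
  · by_cases hP : ∃ i, P i
    · by_cases hQ : ∃ j, Q j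
      · have hR : ∃ n, R n := by
          obtain ⟨i, hi⟩ := hP
          obtain ⟨j, hj⟩ := hQ
          exact ⟨_, (h _).2 ⟨i, j, rfl, hi, hj⟩⟩
        have : Nonempty {n // P n} := ⟨_, hP.choose_spec⟩
        have : Nonempty {n // Q n} := ⟨_, hQ.choose_spec⟩
        rw [hcoe P hP, hcoe Q hQ, hcoe R hR, ← WithBot.coe_add, WithBot.coe_le_coe]
        refine ENat.iSup_add_iSup_le fun i j => ?_
        rw [← Nat.cast_add]
        exact le_iSup (fun n : {n // R n} => ((n : ℕ) : ℕ∞)) ⟨_, (h _).2 ⟨i, j, rfl, i.2, j.2⟩⟩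
      · push Not at hQ
        simp [hQ]
    · push Not at hP
      simp [hP]

end Extrema

/-- Grade and cohomological dimension of an external tensor product over a field are additive. -/
theorem theorem2p6 (k : Type w) [Field k]
    (A : Type u₁) [CommRing A] [Algebra k A] [IsNoetherianRing A]
    (B : Type u₂) [CommRing B] [Algebra k B] [IsNoetherianRing B]
    [IsNoetherianRing (A ⊗[k] B)]
    (I : Ideal A) (J : Ideal B)
    (L : Type u₁) [AddCommGroup L] [Module k L] [Module A L] [IsScalarTower k A L]
    [Module.Finite A L] [Nontrivial L]
    (N : Type u₂) [AddCommGroup N] [Module k N] [Module B N] [IsScalarTower k B N]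
    [Module.Finite B N] [Nontrivial N] :
    letI : Module (A ⊗[k] B) (L ⊗[k] N) := externalTensorModule k A B L N
    lcGrade (tensorSumIdeal k I J) (L ⊗[k] N) = lcGrade I L + lcGrade J N ∧
      lcCd (tensorSumIdeal k I J) (L ⊗[k] N) = lcCd I L + lcCd J N := by
  exact ⟨iInf_coe_add_of_forall_iff _ _ _ fun n =>
      not_isZero_localCohomology_tensorProduct_iff k A B I J L N n,
    iSup_coe_add_of_forall_iff _ _ _ fun n =>
      not_isZero_localCohomology_tensorProduct_iff k A B I J L N n⟩
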